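/- **Setting.** For an even integer $n$ let $\mathcal B\subset\{-1,+1\}^n$ be the set of balanced sign vectors ($\sum_j u_j=0$). The $(m,n,\lambda)$-Poisson ensemble ($\lambda>0$) is the law of an $m\times n$ random matrix $A$ with i.i.d. Poisson$(\lambda)$ entries; $A_i$ denotes its $i$-th row and $W=(W_1,\dots,W_m)$, $W_i=\sum_{j}A_{ij}$, its vector of row sums. Given non-negative integers $r_1,\dots,r_m$ put $\mathcal K_i=\{0,\pm1,\dots,\pm r_i\}$, $G_i=\{u\in\mathcal B:\langle u,A_i\rangle\in\mathcal K_i\}$ and $Z=|\bigcap_{i=1}^m G_i|$. For a given $w$ and for $u,v\in\mathcal B$ which agree on exactly $\beta n$ coordinates, write $\psi_i=\mathbb P[u\in G_i\mid W=w]$ and $\phi_i(\beta)=\mathbb P[u\in G_i,\ v\in G_i\mid W=w]$. **Theorem.** For every constant $C_0$ there are constants $C>0$, $\varepsilon>0$ and $C_\delta>0$ (one for each $\delta\in(0,1/2)$), depending only on $C_0$, such that the following holds. Consider any sequence of instances indexed by $k\in\mathbb N$: $m=m_k\to\infty$, even $n=n_k$ with $m=\mathrm o(n)$, rates $\lambda=\lambda_k>0$,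 even non-negative row sums $w=(w_i)_{i=1}^m\in(2\mathbb N)^m$ and integers $r_i\ge 0$ with $r_i\le C_0\sqrt{w_i}$ for all $i\in[m]$ and all sufficiently large $k$ (that is, $r_i=\mathrm O(\sqrt{w_i})$). Let $A$ be drawn from the $(m,n,\lambda)$-Poisson ensemble conditioned on $W=w$. Then: 1. (Weak bound) for all sufficiently large $k$, for every $\delta\in(0,1/2)$, $$\phi_i(\beta)\le C_\delta\,\psi_i^2\qquad\text{for all } i\in[m]\text{ and all }\beta\in[\delta,1-\delta];$$ 2. (Strong bound) there is a sequence $\eta_k=\mathrm o(1/m_k)$ such that for all sufficiently large $k$, $$\phi_i\left(\tfrac12+x\right)\le(1+\eta_k)(1+Cx^2)\,\psi_i^2\qquad\text{for all } i\in[m]\text{ and all }|x|<\varepsilon;$$ 3. if moreover, for some constant $c>0$, $\log\mathbb E[Z\mid W=w]>cn$ for all sufficiently large $k$, then $$\mathbb E[Z^2\mid W=w]=(1+\mathrm o(1))\,\mathbb E[Z\mid W=w]^2\qquad\text{as }k\to\infty.$$ In 1 and 2, $\beta$ (respectively $\tfrac12+x$) ranges over the values realised by pairs $u,v\in\mathcal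 B$, and the bounds hold for every such pair. -/

import Mathlib

open MeasureTheory ProbabilityTheory Filter Topology Asymptotics Finset
open scoped NNReal

noncomputable section

/-- The law of an `m × n` matrix `A` (as a function `A i j`) with i.i.d. Poisson(`lam`) entries. -/
def poissonEnsemble (m n : ℕ) (lam : ℝ≥0) : Measure (Fin m → Fin n → ℕ) :=
  Measure.pi fun _ : Fin m => Measure.pi fun _ : Fin n => poissonMeasure lam

/-- The event that the vector of row sums equals `w`. -/
def rowSumEvent {m : ℕ} (n : ℕ) (w : Fin m → ℕ) : Set (Fin m → Fin n → ℕ) :=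
  {A | ∀ i, ∑ j, A i j = w i}

/-- The law of the Poisson ensemble conditioned on the row-sum vector being `w`. -/
def condPoissonEnsemble (m n : ℕ) (lam : ℝ≥0) (w : Fin m → ℕ) :
    Measure (Fin m → Fin n → ℕ) :=
  ProbabilityTheory.cond (poissonEnsemble m n lam) (rowSumEvent n w)

/-- The set `𝓑` of balanced sign vectors: entries `±1`, summing to `0`. -/
def balanced (n : ℕ) : Finset (Fin n → ℤ) :=
  {u ∈ Fintype.piFinset (fun _ : Fin n => ({-1, 1} : Finset ℤ)) | ∑ j, u j = 0}

/-- `⟨u, A_i⟩`, the inner product of `u` with the `i`-th row of `A`. -/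
def rowInner {m n : ℕ} (A : Fin m → Fin n → ℕ) (i : Fin m) (u : Fin n → ℤ) : ℤ :=
  ∑ j, u j * (A i j : ℤ)

/-- `G_i`: the balanced vectors whose inner product with the `i`-th row of `A` lies in `K i`. -/
def goodSet {m n : ℕ} (K : Fin m → Set ℤ) (A : Fin m → Fin n → ℕ) (i : Fin m) :
    Set (Fin n → ℤ) :=
  {u | u ∈ balanced n ∧ rowInner A i u ∈ K i}

open Classical in
/-- `Z`: the number of balanced vectors lying in all the sets `G_i`. -/
def numSolutions {m n : ℕ} (K : Fin m → Set ℤ) (A : Fin m → Fin n → ℕ) : ℕ :=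
  #{u ∈ balanced n | ∀ i, u ∈ goodSet K A i}

/-- `E[Z ^ p]` when the matrix has law `μ`. -/
def momentZ {m n : ℕ} (μ : Measure (Fin m → Fin n → ℕ)) (K : Fin m → Set ℤ) (p : ℕ) : ℝ :=
  ∫ A, (numSolutions K A : ℝ) ^ p ∂μ

/-- `ψ_i = P(u ∈ G_i)`. -/
def psi {m n : ℕ} (μ : Measure (Fin m → Fin n → ℕ)) (K : Fin m → Set ℤ) (i : Fin m)
    (u : Fin n → ℤ) : ℝ :=
  μ.real {A | u ∈ goodSet K A i}

/-- `φ_i = P(u ∈ G_i, v ∈ G_i)`. -/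
def phi {m n : ℕ} (μ : Measure (Fin m → Fin n → ℕ)) (K : Fin m → Set ℤ) (i : Fin m)
    (u v : Fin n → ℤ) : ℝ :=
  μ.real {A | u ∈ goodSet K A i ∧ v ∈ goodSet K A i}

/-- The fraction `β` of the coordinates on which `u` and `v` agree. -/
def agreement {n : ℕ} (u v : Fin n → ℤ) : ℝ :=
  (#{j | u j = v j} : ℝ) / n

/-- The weak bound with constants `Cw δ`: for all large `k` and all `δ ∈ (0, 1/2)`,
`φ_i(β) ≤ Cw δ * ψ_i²` for all rows `i` and all `β ∈ [δ, 1 - δ]`. -/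
def WeakBound (m n : ℕ → ℕ) (μ : ∀ k, Measure (Fin (m k) → Fin (n k) → ℕ))
    (K : ∀ k, Fin (m k) → Set ℤ) (Cw : ℝ → ℝ) : Prop :=
  ∀ᶠ k in atTop, ∀ δ ∈ Set.Ioo (0 : ℝ) (1 / 2), ∀ i : Fin (m k),
    ∀ u ∈ balanced (n k), ∀ v ∈ balanced (n k),
      agreement u v ∈ Set.Icc δ (1 - δ) →
        phi (μ k) (K k) i u v ≤ Cw δ * psi (μ k) (K k) i u ^ 2

/-- The strong bound with constants `C` and `ε`: for all large `k`,
`φ_i(1/2 + x) ≤ (1 + o(1/m)) (1 + C x²) ψ_i²` for all rows `i` and all `|x| < ε`,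
with an error term `η k = o(1/m)` that does not depend on `i` or `x`. -/
def StrongBound (m n : ℕ → ℕ) (μ : ∀ k, Measure (Fin (m k) → Fin (n k) → ℕ))
    (K : ∀ k, Fin (m k) → Set ℤ) (C ε : ℝ) : Prop :=
  ∃ η : ℕ → ℝ, (η =o[atTop] fun k => 1 / (m k : ℝ)) ∧
    ∀ᶠ k in atTop, ∀ i : Fin (m k),
      ∀ u ∈ balanced (n k), ∀ v ∈ balanced (n k), ∀ x : ℝ,
        agreement u v = 1 / 2 + x → |x| < ε →
          phi (μ k) (K k) i u v ≤ (1 + η k) * (1 + C * x ^ 2) * psi (μ k) (K k) i u ^ 2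

/-- The windows `K_i = {0, ±1, …, ±r_i}`. -/
def window {m : ℕ} (r : Fin m → ℕ) (i : Fin m) : Set ℤ :=
  Set.Icc (-(r i : ℤ)) (r i)

end

/-! Given the row sums, the rows are independent and row `i` is the occupancy vector of `w i`
uniform balls in `n` cells. So `⟨u, A_i⟩` is the sum of `u` over the cells hit: as `u` is balanced,
a simple random walk of length `w i`. For a pair `u, v` one gets two walks with step correlation `ρ
= 2β - 1`, hence `ψ_i = walkProb` and `φ_i = pairProb` at `ρ`.

By Walsh expansion `pairProb` is `∑ ρ ^ #S` times squared coefficients, and the symmetry of the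
window kills odd `#S`. Hence the excess `φ_i - ψ_i²` is nonnegative, and divided by `ρ²` it is
nondecreasing in `|ρ|` (`pairProb_sub_le`). A bound `φ_i ≤ K ψ_i²` at the single value `ρ = 1 - 2δ`
therefore yields both the weak bound and, with no error term, the strong one. That bound holds
because both sides have order `(r+1)²/(w+1)`: from above by splitting the walks at the times their
steps agree (`pairProb_le`), from below because a window of width `O(√w)` gets its share of the bulk
of an even-length walk (`le_walkProb`).

For the second moment, pairs with `|ρ| ≤ 1 - 2δ` contribute at most `exp(D m ρ²)` relative to the
squared mean. Since `nρ²` has a bounded exponential moment and `m = o(n)`, they total `1 + o(1)`.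
The nearly parallel pairs are exponentially few per vector, at a rate below the growth rate `c` of
the mean, hence negligible. The matching lower bound is the positivity of the excess. -/

/-! ### Balls in cells and the conditioned ensemble -/

/-- The occupancy vector of a placement of `w` balls into `n` cells. -/
def occupancy {n w : ℕ} (s : Fin w → Fin n) (j : Fin n) : ℕ := #{t | s t = j}

lemma sum_occupancy {n w : ℕ} (s : Fin w → Fin n) : ∑ j, occupancy s j = w := by
  simpa [occupancy] using (Finset.card_eq_sum_card_fiberwise (s := univ) (t := univ)
    (f := s) (by simp)).symm

lemma sum_mul_occupancy {n w : ℕ} (s : Fin w → Fin n) (u : Fin n → ℤ) :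
    ∑ j, u j * (occupancy s j : ℤ) = ∑ t, u (s t) := by
  rw [← Finset.sum_fiberwise (s := univ) (g := s)]
  refine Finset.sum_congr rfl fun j _ => ?_
  rw [Finset.sum_congr rfl (g := fun _ => u j)]
  · simp [occupancy, mul_comm]
  · intro t ht
    simp only [Finset.mem_filter] at ht
    rw [ht.2]

/-- Expand `(X_1 + ⋯ + X_n)^w` over words and by the multinomial theorem, then compare the
coefficients of the monomial with exponent `a`. -/
lemma card_occupancy_eq_multinomial {n w : ℕ} {a : Fin n → ℕ} (ha : ∑ j, a j = w) :
    #{s : Fin w → Fin n | occupancy s = a} = Nat.multinomial univ a := by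
  have h1 := Finset.sum_pow_eq_sum_piAntidiag (univ : Finset (Fin n))
    (fun j => (MvPolynomial.X j : MvPolynomial (Fin n) ℕ)) w
  rw [Fintype.sum_pow] at h1
  have hm : ∀ b : Fin n → ℕ, ∏ j, (MvPolynomial.X j : MvPolynomial (Fin n) ℕ) ^ b j
      = MvPolynomial.monomial (Finsupp.equivFunOnFinite.symm b) 1 := by
    intro b
    rw [MvPolynomial.monomial_eq, Finsupp.prod_fintype _ _ (by simp)]
    simp
  have hs : ∀ s : Fin w → Fin n, ∏ t, (MvPolynomial.X (s t) : MvPolynomial (Fin n) ℕ)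
      = MvPolynomial.monomial (Finsupp.equivFunOnFinite.symm (occupancy s)) 1 := by
    intro s
    rw [← hm, ← Finset.prod_fiberwise (s := univ) (g := s)]
    refine Finset.prod_congr rfl fun j _ => ?_
    rw [Finset.prod_congr rfl (g := fun _ => MvPolynomial.X j)]
    · simp [occupancy]
    · intro t ht
      simp only [Finset.mem_filter] at ht
      rw [ht.2]
  have h2 := congrArg (MvPolynomial.coeff (Finsupp.equivFunOnFinite.symm a)) h1
  simp only [hs, hm] at h2
  simp only [MvPolynomial.coeff_sum, MvPolynomial.coeff_monomial, EmbeddingLike.apply_eq_iff_eq,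
    ← nsmul_eq_mul, MvPolynomial.coeff_smul] at h2
  rw [Finset.card_filter, h2]
  simp [ha]

/-- The probability that the occupancy vector of `w` uniform balls in `n` cells lies in `E`. -/
noncomputable def rowProb (n w : ℕ) (E : Set (Fin n → ℕ)) : ℝ :=
  open Classical in (#{s : Fin w → Fin n | occupancy s ∈ E} : ℝ) / (n : ℝ) ^ w

lemma rowProb_univ {n : ℕ} (hn : 0 < n) (w : ℕ) : rowProb n w Set.univ = 1 := by
  simp [rowProb, hn.ne']

/-- The Poisson mass of `a` is a factor depending only on `∑ a j` divided by `∏ (a j)!`, so it is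
proportional to a multinomial coefficient. The prefactor cancels on conditioning, and with it the
rate. -/
lemma poisson_row_real {n : ℕ} (hn : 0 < n) (lam : ℝ≥0) (w : ℕ)
    (E : Set (Fin n → ℕ)) :
    (Measure.pi fun _ : Fin n => poissonMeasure lam).real ({a | ∑ j, a j = w} ∩ E)
      = Real.exp (-(n * lam)) * (n * lam) ^ w / w.factorial * rowProb n w E := by
  classical
  have hset : ({a : Fin n → ℕ | ∑ j, a j = w} ∩ E)
      = (({a ∈ Finset.piAntidiag univ w | a ∈ E} : Finset (Fin n → ℕ)) : Set (Fin n → ℕ)) := by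
    ext a; simp
  rw [hset, ← sum_measureReal_singleton]
  have hpt : ∀ a ∈ Finset.piAntidiag (univ : Finset (Fin n)) w,
      (Measure.pi fun _ : Fin n => poissonMeasure lam).real {a}
        = Real.exp (-(n * lam)) * lam ^ w / w.factorial * (#{s : Fin w → Fin n | occupancy s = a} : ℝ) := by
    intro a ha
    have ha' : ∑ j, a j = w := by simpa using ha
    rw [card_occupancy_eq_multinomial ha', measureReal_def, Measure.pi_singleton,
      ENNReal.toReal_prod]
    have : ∀ j, (poissonMeasure lam {a j}).toReal
        = Real.exp (-lam) * lam ^ a j / (a j).factorial := fun j =>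
      poissonMeasure_real_singleton lam (a j)
    simp_rw [this]
    have hsp := Nat.multinomial_spec univ a
    rw [ha'] at hsp
    rw [Finset.prod_div_distrib, Finset.prod_mul_distrib, Finset.prod_pow_eq_pow_sum, ha',
      Finset.prod_const, ← Real.exp_nat_mul, ← hsp]
    have h1 : (∏ j, ((a j).factorial : ℝ)) ≠ 0 :=
      Finset.prod_ne_zero_iff.2 fun j _ => by positivity
    have h2 : (Nat.multinomial univ a : ℝ) ≠ 0 := by
      have := Nat.multinomial_pos univ a
      positivity
    push_cast
    simp only [card_univ, Fintype.card_fin, mul_neg]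
    field_simp
  rw [Finset.sum_congr rfl fun a ha => hpt a (Finset.mem_filter.1 ha).1, ← Finset.mul_sum, rowProb]
  have hcount : (#{s : Fin w → Fin n | occupancy s ∈ E} : ℝ)
      = ∑ a ∈ Finset.piAntidiag univ w with a ∈ E, (#{s : Fin w → Fin n | occupancy s = a} : ℝ) := by
    norm_cast
    rw [Finset.card_eq_sum_card_fiberwise (f := occupancy)
      (t := {a ∈ Finset.piAntidiag univ w | a ∈ E})]
    · refine Finset.sum_congr rfl fun a ha => ?_
      congr 1
      ext s
      simp only [Finset.mem_filter, Finset.mem_univ, true_and] at ha ⊢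
      exact ⟨fun h => h.2, fun h => ⟨h ▸ ha.2, h⟩⟩
    · intro s hs
      simpa [sum_occupancy] using hs
  rw [hcount]
  have : (n : ℝ) ≠ 0 := by positivity
  field_simp
  ring

/-- Conditioned on the row sums, the rows are independent multinomial vectors. -/
theorem condPoissonEnsemble_real_forall {m n : ℕ} (hn : 0 < n) {lam : ℝ≥0} (hl : 0 < lam)
    (w : Fin m → ℕ) (E : Fin m → Set (Fin n → ℕ)) :
    (condPoissonEnsemble m n lam w).real {A | ∀ i, A i ∈ E i} = ∏ i, rowProb n (w i) (E i) := by
  have key : ∀ E : Fin m → Set (Fin n → ℕ),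
      (poissonEnsemble m n lam).real (rowSumEvent n w ∩ {A | ∀ i, A i ∈ E i})
      = ∏ i, (Real.exp (-(n * lam)) * (n * lam) ^ w i / (w i).factorial * rowProb n (w i) (E i)) := by
    intro E
    have : rowSumEvent n w ∩ {A | ∀ i, A i ∈ E i}
        = Set.pi Set.univ fun i => ({a : Fin n → ℕ | ∑ j, a j = w i} ∩ E i) := by
      ext A; simp [rowSumEvent, forall_and]
    rw [this, measureReal_def, poissonEnsemble, Measure.pi_pi, ENNReal.toReal_prod]
    exact Finset.prod_congr rfl fun i _ => poisson_row_real hn lam (w i) (E i)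
  have h0 := key fun _ => Set.univ
  simp only [Set.mem_univ, implies_true, Set.ofPred_true, Set.inter_univ, rowProb_univ hn,
    mul_one] at h0
  have hne : ∀ i, Real.exp (-(n * lam)) * ((n : ℝ) * lam) ^ w i / (w i).factorial ≠ 0 := by
    intro i
    have : (0 : ℝ) < lam := hl
    positivity
  rw [measureReal_def, condPoissonEnsemble, cond_apply (MeasurableSet.of_discrete),
    ENNReal.toReal_mul, ENNReal.toReal_inv, ← measureReal_def, ← measureReal_def, key, h0,
    Finset.prod_mul_distrib, ← mul_assoc, inv_mul_cancel₀, one_mul]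
  exact Finset.prod_ne_zero_iff.2 fun i _ => hne i

/-! ### Row events as random walk events -/

/-- The sum of a vector of signs. -/
def signSum {ι : Type*} [Fintype ι] (s : ι → ℤˣ) : ℤ := ∑ t, (s t : ℤ)

/-- The indicator of `|x| ≤ r`. -/
noncomputable def windowInd (r : ℕ) (x : ℤ) : ℝ := if |x| ≤ r then 1 else 0

/-- The probability that a `w`-step simple random walk ends in `[-r, r]`. -/
noncomputable def walkProb (w r : ℕ) : ℝ :=
  (∑ s : Fin w → ℤˣ, windowInd r (signSum s)) / 2 ^ w

/-- The probability that two simple random walks with `ρ`-correlated steps both end in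
`[-r, r]`. -/
noncomputable def pairProb (w r : ℕ) (ρ : ℝ) : ℝ :=
  ∑ s : Fin w → ℤˣ, ∑ s' : Fin w → ℤˣ, windowInd r (signSum s) * windowInd r (signSum s') *
    ∏ t, ((1 + ρ * ((s t : ℤ) : ℝ) * ((s' t : ℤ) : ℝ)) / 4)

lemma windowInd_nonneg (r : ℕ) (x : ℤ) : 0 ≤ windowInd r x := by
  unfold windowInd; split_ifs <;> norm_num

lemma windowInd_neg (r : ℕ) (x : ℤ) : windowInd r (-x) = windowInd r x := by
  simp [windowInd]

lemma signSum_neg {ι : Type*} [Fintype ι] (s : ι → ℤˣ) : signSum (-s) = -signSum s := by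
  simp [signSum]

lemma unit_sq_cast (a : ℤˣ) : ((a : ℤ) : ℝ) * ((a : ℤ) : ℝ) = 1 := by
  rcases Int.units_eq_one_or a with h | h <;> simp [h]

/-- In this character form, summing over cells lets balance remove the linear terms. -/
lemma indicator_unit_eq (a b : ℤˣ) :
    (if a = b then (1 : ℝ) else 0) = (1 + ((b : ℤ) : ℝ) * ((a : ℤ) : ℝ)) / 2 := by
  rcases Int.units_eq_one_or a with h | h <;> rcases Int.units_eq_one_or b with h' | h' <;>
    subst h <;> subst h' <;> norm_num

lemma sum_comp_eq_sum_mul_prod_card {κ : Type*} [Fintype κ] [DecidableEq κ] {n w : ℕ}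
    (g : Fin n → κ) (G : (Fin w → κ) → ℝ) :
    ∑ s : Fin w → Fin n, G (g ∘ s) = ∑ c : Fin w → κ, G c * ∏ t, ∑ j, if g j = c t then 1 else 0 := by
  simp_rw [Fintype.prod_sum, Finset.mul_sum]
  rw [Finset.sum_comm]
  refine Finset.sum_congr rfl fun s _ => ?_
  rw [Finset.sum_eq_single (g ∘ s)]
  · simp
  · intro c _ hc
    obtain ⟨t, ht⟩ := Function.ne_iff.1 hc
    rw [Finset.prod_eq_zero (Finset.mem_univ t), mul_zero]
    rw [if_neg]
    exact fun h => ht h.symm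
  · simp

lemma mem_balanced_iff {n : ℕ} {u : Fin n → ℤ} :
    u ∈ balanced n ↔ ∃ s : Fin n → ℤˣ, signSum s = 0 ∧ u = fun j => (s j : ℤ) := by
  constructor
  · intro hu
    simp only [balanced, Finset.mem_filter, Fintype.mem_piFinset, Finset.mem_insert,
      Finset.mem_singleton] at hu
    refine ⟨fun j => if u j = 1 then 1 else -1, ?_, ?_⟩
    · rw [← hu.2]
      refine Finset.sum_congr rfl fun j _ => ?_
      rcases hu.1 j with h | h <;> simp [h]
    · ext j
      rcases hu.1 j with h | h <;> simp [h]
  · rintro ⟨s, hs, rfl⟩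
    simp only [balanced, Finset.mem_filter, Fintype.mem_piFinset, Finset.mem_insert,
      Finset.mem_singleton]
    refine ⟨fun j => ?_, hs⟩
    rcases Int.units_eq_one_or (s j) with h | h <;> simp [h]

lemma rowProb_window {n : ℕ} (hn : 0 < n) (w r : ℕ) {u : Fin n → ℤ} (hu : u ∈ balanced n) :
    rowProb n w {a | ∑ j, u j * (a j : ℤ) ∈ Set.Icc (-(r : ℤ)) r} = walkProb w r := by
  classical
  obtain ⟨U, hU, rfl⟩ := mem_balanced_iff.1 hu
  have hcell : ∀ c : ℤˣ, ∑ j, (if U j = c then (1 : ℝ) else 0) = n / 2 := by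
    intro c
    simp_rw [indicator_unit_eq, ← Finset.sum_div, Finset.sum_add_distrib, ← Finset.mul_sum]
    have : ∑ j, ((U j : ℤ) : ℝ) = 0 := by exact_mod_cast hU
    simp [this]
  have h := sum_comp_eq_sum_mul_prod_card U (fun s : Fin w → ℤˣ => windowInd r (signSum s))
  simp only [hcell, Finset.prod_const, Finset.card_univ, Fintype.card_fin,
    ← Finset.sum_mul] at h
  rw [rowProb, walkProb, Finset.card_filter]
  have h' : ∀ s : Fin w → Fin n, ((if occupancy s ∈ {a : Fin n → ℕ | ∑ j, (U j : ℤ) * (a j : ℤ) ∈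
      Set.Icc (-(r : ℤ)) r} then 1 else 0 : ℕ) : ℝ) = windowInd r (signSum (U ∘ s)) := by
    intro s
    simp only [Set.mem_ofPred_eq, sum_mul_occupancy s fun j => (U j : ℤ), windowInd, abs_le,
      Set.mem_Icc]
    simp [signSum]
  push_cast [Nat.cast_sum]
  have : (n : ℝ) ≠ 0 := by positivity
  rw [Finset.sum_congr rfl fun s _ => (by simpa using h' s), h, div_pow]
  field_simp

/-- The joint law of two signs is determined by both means and the correlation. Balance makes the
means zero, so the class `(c.1, c.2)` has `n (1 + ρ c.1 c.2) / 4` cells. -/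
lemma rowProb_window_pair {n : ℕ} (hn : 0 < n) (w r : ℕ) {u v : Fin n → ℤ}
    (hu : u ∈ balanced n) (hv : v ∈ balanced n) :
    rowProb n w {a | ∑ j, u j * (a j : ℤ) ∈ Set.Icc (-(r : ℤ)) r ∧
      ∑ j, v j * (a j : ℤ) ∈ Set.Icc (-(r : ℤ)) r}
      = pairProb w r ((∑ j, (u j : ℝ) * v j) / n) := by
  classical
  obtain ⟨U, hU, rfl⟩ := mem_balanced_iff.1 hu
  obtain ⟨V, hV, rfl⟩ := mem_balanced_iff.1 hv
  set ρ : ℝ := (∑ j, ((U j : ℤ) : ℝ) * (V j : ℤ)) / n with hρ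
  have hn' : (n : ℝ) ≠ 0 := by positivity
  have hU' : ∑ j, ((U j : ℤ) : ℝ) = 0 := by exact_mod_cast hU
  have hV' : ∑ j, ((V j : ℤ) : ℝ) = 0 := by exact_mod_cast hV
  have hcell : ∀ c : ℤˣ × ℤˣ, ∑ j, (if (U j, V j) = c then (1 : ℝ) else 0)
      = n * ((1 + ρ * ((c.1 : ℤ) : ℝ) * ((c.2 : ℤ) : ℝ)) / 4) := by
    intro c
    have : ∀ j, (if (U j, V j) = c then (1 : ℝ) else 0)
        = (1 + ((c.1 : ℤ) : ℝ) * (U j : ℤ) + (c.2 : ℤ) * (V j : ℤ)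
          + (c.1 : ℤ) * (c.2 : ℤ) * (((U j : ℤ) : ℝ) * (V j : ℤ))) / 4 := by
      intro j
      have e : (if (U j, V j) = c then (1 : ℝ) else 0)
          = (if U j = c.1 then (1 : ℝ) else 0) * (if V j = c.2 then (1 : ℝ) else 0) := by
        rw [ite_zero_mul_ite_zero]; simp [Prod.ext_iff]
      rw [e, indicator_unit_eq, indicator_unit_eq]
      ring
    simp_rw [this, ← Finset.sum_div, Finset.sum_add_distrib, ← Finset.mul_sum, hU', hV', hρ]
    simp only [Finset.sum_const, Finset.card_univ, Fintype.card_fin, nsmul_eq_mul]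
    field_simp
    ring
  have h := sum_comp_eq_sum_mul_prod_card (fun j => (U j, V j)) (fun s : Fin w → ℤˣ × ℤˣ =>
    windowInd r (signSum fun t => (s t).1) * windowInd r (signSum fun t => (s t).2))
  simp only [hcell, Finset.prod_mul_distrib, Finset.prod_const, Finset.card_univ, Fintype.card_fin,
    mul_left_comm _ ((n : ℝ) ^ w), ← Finset.mul_sum] at h
  have hpair : pairProb w r ρ = ∑ c : Fin w → ℤˣ × ℤˣ,
      windowInd r (signSum fun t => (c t).1) * windowInd r (signSum fun t => (c t).2) *
        ∏ t, ((1 + ρ * (((c t).1 : ℤ) : ℝ) * (((c t).2 : ℤ) : ℝ)) / 4) := by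
    rw [pairProb, ← Fintype.sum_prod_type', ← (Equiv.arrowProdEquivProdArrow _ _ _).sum_comp]
    rfl
  rw [← hpair] at h
  rw [rowProb, Finset.card_filter]
  have h' : ∀ s : Fin w → Fin n, ((if occupancy s ∈ {a : Fin n → ℕ |
      ∑ j, (U j : ℤ) * (a j : ℤ) ∈ Set.Icc (-(r : ℤ)) r ∧
      ∑ j, (V j : ℤ) * (a j : ℤ) ∈ Set.Icc (-(r : ℤ)) r} then 1 else 0 : ℕ) : ℝ)
      = windowInd r (signSum (U ∘ s)) * windowInd r (signSum (V ∘ s)) := by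
    intro s
    simp only [Set.mem_ofPred_eq, sum_mul_occupancy s fun j => (U j : ℤ),
      sum_mul_occupancy s fun j => (V j : ℤ), windowInd, abs_le, Set.mem_Icc]
    rw [ite_zero_mul_ite_zero]
    simp [signSum]
  push_cast [Nat.cast_sum]
  rw [Finset.sum_congr rfl fun s _ => (by simpa using h' s)]
  rw [div_eq_iff (by positivity), mul_comm, ← h]
  rfl

/-! ### Walsh expansion of the pair probability -/

/-- The Walsh coefficient at `S` of the indicator of `|signSum| ≤ r`. -/
noncomputable def walsh (w r : ℕ) (S : Finset (Fin w)) : ℝ :=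
  ∑ s : Fin w → ℤˣ, windowInd r (signSum s) * ∏ t ∈ S, ((s t : ℤ) : ℝ)

/-- The global flip `s ↦ -s` preserves the window and negates an odd character. -/
lemma walsh_eq_zero_of_odd {w r : ℕ} {S : Finset (Fin w)} (hS : Odd #S) : walsh w r S = 0 := by
  have h : walsh w r S = -walsh w r S := by
    conv_lhs => rw [walsh, ← Equiv.sum_comp (Equiv.neg (Fin w → ℤˣ))]
    rw [walsh, ← Finset.sum_neg_distrib]
    refine Finset.sum_congr rfl fun s _ => ?_
    simp [signSum_neg, windowInd_neg, Finset.prod_neg, hS.neg_one_pow]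
  linarith

/-- Expanding `∏ (1 + ρ s s')` over subsets gives terms that factor into an `s` part and an `s'`
part. -/
lemma pairProb_eq_sum_walsh (w r : ℕ) (ρ : ℝ) :
    pairProb w r ρ = ∑ S : Finset (Fin w), ρ ^ #S * (walsh w r S / 2 ^ w) ^ 2 := by
  have h1 : ∀ s s' : Fin w → ℤˣ, ∏ t, ((1 + ρ * ((s t : ℤ) : ℝ) * ((s' t : ℤ) : ℝ)) / 4)
      = ∑ S : Finset (Fin w), ρ ^ #S * (∏ t ∈ S, ((s t : ℤ) : ℝ)) * (∏ t ∈ S, ((s' t : ℤ) : ℝ))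
        / 4 ^ w := by
    intro s s'
    rw [Finset.prod_div_distrib, Finset.prod_one_add, Finset.powerset_univ, Finset.sum_div]
    simp [Finset.prod_mul_distrib]
  simp_rw [pairProb, h1, Finset.mul_sum]
  rw [Finset.sum_congr rfl fun s _ => Finset.sum_comm, Finset.sum_comm]
  refine Finset.sum_congr rfl fun S _ => ?_
  rw [div_pow, sq (walsh w r S), walsh, Finset.sum_mul_sum, Finset.sum_div, Finset.mul_sum,
    ← pow_mul, mul_comm w 2, pow_mul]
  refine Finset.sum_congr rfl fun s _ => ?_
  rw [Finset.sum_div, Finset.mul_sum]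
  refine Finset.sum_congr rfl fun s' _ => ?_
  norm_num
  ring

lemma walsh_empty (w r : ℕ) : walsh w r ∅ / 2 ^ w = walkProb w r := by
  simp [walsh, walkProb]

lemma sq_walkProb_le_pairProb (w r : ℕ) (ρ : ℝ) : walkProb w r ^ 2 ≤ pairProb w r ρ := by
  rw [pairProb_eq_sum_walsh]
  have h : ∀ S ∈ (univ : Finset (Finset (Fin w))), 0 ≤ ρ ^ #S * (walsh w r S / 2 ^ w) ^ 2 := by
    intro S _
    rcases Nat.even_or_odd #S with hS | hS
    · exact mul_nonneg (hS.pow_nonneg ρ) (sq_nonneg _)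
    · simp [walsh_eq_zero_of_odd hS]
  have := Finset.single_le_sum h (Finset.mem_univ ∅)
  simpa [walsh_empty] using this

/-- Only nonempty even `S` contribute to the excess, so `#S ≥ 2`: a factor `(ρ / ρ₀) ^ 2` comes out,
and the remaining power of `|ρ|` is at most that of `ρ₀`. -/
lemma pairProb_sub_le {w r : ℕ} {ρ ρ₀ : ℝ} (h0 : 0 < ρ₀) (h : |ρ| ≤ ρ₀) :
    pairProb w r ρ - walkProb w r ^ 2 ≤ (ρ / ρ₀) ^ 2 * (pairProb w r ρ₀ - walkProb w r ^ 2) := by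
  have e : ∀ ρ : ℝ, pairProb w r ρ - walkProb w r ^ 2
      = ∑ S ∈ (univ : Finset (Finset (Fin w))).erase ∅, ρ ^ #S * (walsh w r S / 2 ^ w) ^ 2 := by
    intro ρ
    rw [pairProb_eq_sum_walsh, ← Finset.add_sum_erase _ _ (Finset.mem_univ ∅)]
    simp [walsh_empty]
  rw [e, e, Finset.mul_sum]
  refine Finset.sum_le_sum fun S hS => ?_
  rcases Nat.even_or_odd #S with hE | hO
  · rw [← mul_assoc]
    refine mul_le_mul_of_nonneg_right ?_ (sq_nonneg _)
    have hpos : #S ≠ 0 := by simpa using hS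
    obtain ⟨k, hk⟩ : ∃ k, #S = 2 + k := ⟨#S - 2, by obtain ⟨a, ha⟩ := hE; omega⟩
    rw [← hE.pow_abs, hk, pow_add, pow_add, div_pow, sq_abs]
    have : |ρ| ^ k ≤ ρ₀ ^ k := pow_le_pow_left₀ (abs_nonneg _) h k
    calc ρ ^ 2 * |ρ| ^ k ≤ ρ ^ 2 * ρ₀ ^ k := by gcongr
      _ = _ := by field_simp
  · simp [walsh_eq_zero_of_odd hO]

/-! ### Binomial estimates and point probabilities -/

lemma centralBinom_sq_mul_le (h : ℕ) : h.centralBinom ^ 2 * (2 * h + 1) ≤ 16 ^ h := by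
  induction h with
  | zero => simp
  | succ h ih =>
    have e := Nat.succ_mul_centralBinom_succ h
    have : (h + 1) ^ 2 * ((h + 1).centralBinom ^ 2 * (2 * (h + 1) + 1))
        ≤ (h + 1) ^ 2 * 16 ^ (h + 1) := by
      calc (h + 1) ^ 2 * ((h + 1).centralBinom ^ 2 * (2 * (h + 1) + 1))
          = ((h + 1) * (h + 1).centralBinom) ^ 2 * (2 * h + 3) := by ring
        _ = (h.centralBinom ^ 2 * (2 * h + 1)) * (4 * ((2 * h + 1) * (2 * h + 3))) := by
            rw [e]; ring
        _ ≤ 16 ^ h * (4 * (4 * (h + 1) ^ 2)) := Nat.mul_le_mul ih (by nlinarith)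
        _ = _ := by ring
    exact Nat.le_of_mul_le_mul_left this (by positivity)

lemma le_centralBinom_sq_mul {h : ℕ} (hh : 1 ≤ h) : 16 ^ h ≤ h.centralBinom ^ 2 * (4 * h) := by
  induction h, hh using Nat.le_induction with
  | base => decide
  | succ h hh ih =>
    have e := Nat.succ_mul_centralBinom_succ h
    have : (h + 1) ^ 2 * 16 ^ (h + 1)
        ≤ (h + 1) ^ 2 * ((h + 1).centralBinom ^ 2 * (4 * (h + 1))) := by
      calc (h + 1) ^ 2 * 16 ^ (h + 1) = 16 ^ h * (16 * (h + 1) ^ 2) := by ring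
        _ ≤ (h.centralBinom ^ 2 * (4 * h)) * (16 * (h + 1) ^ 2) := by gcongr
        _ = h.centralBinom ^ 2 * (h + 1) * (16 * (4 * h ^ 2 + 4 * h)) := by ring
        _ ≤ h.centralBinom ^ 2 * (h + 1) * (16 * (2 * h + 1) ^ 2) := by gcongr; nlinarith
        _ = (2 * (2 * h + 1) * h.centralBinom) ^ 2 * (4 * (h + 1)) := by ring
        _ = _ := by rw [← e]; ring
    exact Nat.le_of_mul_le_mul_left this (by positivity)

lemma choose_sq_mul_le (N k : ℕ) : N.choose k ^ 2 * (N + 1) ≤ 4 ^ N := by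
  refine (Nat.mul_le_mul_right _ (Nat.pow_le_pow_left (Nat.choose_le_middle k N) 2)).trans ?_
  obtain ⟨h, rfl | rfl⟩ := Nat.even_or_odd' N
  · have := centralBinom_sq_mul_le h
    rw [Nat.centralBinom_eq_two_mul_choose] at this
    rw [Nat.mul_div_cancel_left _ (by norm_num), pow_mul]
    simpa using this
  · have := centralBinom_sq_mul_le (h + 1)
    -- An odd row's middle coefficient is half the next central one.
    have e : (h + 1).centralBinom = 2 * (2 * h + 1).choose h := by
      rw [Nat.centralBinom_eq_two_mul_choose, show 2 * (h + 1) = (2 * h + 1) + 1 by ring,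
        Nat.choose_succ_succ, Nat.choose_symm_half]
      ring
    rw [e] at this
    rw [show (2 * h + 1) / 2 = h by omega]
    have e2 : (4 : ℕ) ^ (2 * h + 1) * 4 = 16 ^ (h + 1) := by
      rw [← pow_succ, show (16 : ℕ) = 4 ^ 2 by norm_num, ← pow_mul]; ring
    nlinarith

lemma choose_le_two_pow_div_sqrt (N k : ℕ) : (N.choose k : ℝ) ≤ 2 ^ N / √(N + 1) := by
  rw [le_div_iff₀ (by positivity)]
  refine le_of_sq_le_sq ?_ (by positivity)
  rw [mul_pow, Real.sq_sqrt (by positivity), ← pow_mul, mul_comm N 2, pow_mul]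
  norm_num
  exact_mod_cast choose_sq_mul_le N k

section Signs

variable {ι : Type*} [Fintype ι]

open Classical in
/-- Sign vectors correspond to the sets of their positive coordinates. -/
noncomputable def signEquivFinset (ι : Type*) [Fintype ι] : (ι → ℤˣ) ≃ Finset ι where
  toFun s := {t | s t = 1}
  invFun S t := if t ∈ S then 1 else -1
  left_inv s := by
    ext t
    rcases Int.units_eq_one_or (s t) with h | h <;> simp [h]
  right_inv S := by
    ext t
    simp

lemma signSum_eq (s : ι → ℤˣ) : signSum s = 2 * (#(signEquivFinset ι s) : ℤ) - Fintype.card ι := by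
  classical
  have h : ∀ t, (s t : ℤ) = 2 * (if s t = 1 then 1 else 0) - 1 := by
    intro t
    rcases Int.units_eq_one_or (s t) with h | h <;> simp [h]
  rw [signSum, Finset.sum_congr rfl fun t _ => h t]
  rw [Finset.sum_sub_distrib, ← Finset.mul_sum, Finset.sum_boole]
  simp [signEquivFinset]

lemma card_signSum_eq (ι : Type*) [Fintype ι] [DecidableEq ι] (k : ℕ) :
    #{s : ι → ℤˣ | signSum s = 2 * (k : ℤ) - Fintype.card ι} = (Fintype.card ι).choose k := by
  rw [← Finset.card_univ (α := ι), ← Finset.card_powersetCard]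
  refine Finset.card_equiv (signEquivFinset ι) fun s => ?_
  simp only [Finset.mem_filter, Finset.mem_univ, true_and, Finset.mem_powersetCard,
    Finset.subset_univ, signSum_eq, Finset.card_univ]
  omega

lemma card_signSum_eq_le (ι : Type*) [Fintype ι] [DecidableEq ι] (a : ℤ) :
    (#{s : ι → ℤˣ | signSum s = a} : ℝ) ≤ 2 ^ Fintype.card ι / √(Fintype.card ι + 1) := by
  by_cases h : ∃ s : ι → ℤˣ, signSum s = a
  · obtain ⟨s, rfl⟩ := h
    rw [signSum_eq, card_signSum_eq]
    exact choose_le_two_pow_div_sqrt _ _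
  · push Not at h
    rw [Finset.filter_false_of_mem fun s _ => h s]
    simp only [Finset.card_empty, Nat.cast_zero]
    positivity

lemma sum_windowInd_eq (ι : Type*) [Fintype ι] [DecidableEq ι] (r : ℕ) :
    ∑ s : ι → ℤˣ, windowInd r (signSum s)
      = ∑ a ∈ Finset.Icc (-(r : ℤ)) r, (#{s : ι → ℤˣ | signSum s = a} : ℝ) := by
  simp_rw [Finset.card_filter, Nat.cast_sum]
  rw [Finset.sum_comm]
  refine Finset.sum_congr rfl fun s _ => ?_
  simp [windowInd, abs_le]

lemma sum_windowInd_le (ι : Type*) [Fintype ι] [DecidableEq ι] (r : ℕ) :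
    ∑ s : ι → ℤˣ, windowInd r (signSum s)
      ≤ 2 * (r + 1) * (2 ^ Fintype.card ι / √(Fintype.card ι + 1)) := by
  rw [sum_windowInd_eq]
  refine (Finset.sum_le_card_nsmul _ _ _ fun a _ => card_signSum_eq_le ι a).trans ?_
  rw [nsmul_eq_mul]
  gcongr
  rw [Int.card_Icc]
  have : ((r : ℤ) + 1 - -(r : ℤ)).toNat = 2 * r + 1 := by omega
  rw [this]
  push_cast
  linarith

lemma sum_signSum_reindex {κ : Type*} [Fintype κ] [DecidableEq ι] [DecidableEq κ] (e : ι ≃ κ)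
    (f : ℤ → ℝ) : ∑ s : ι → ℤˣ, f (signSum s) = ∑ s : κ → ℤˣ, f (signSum s) := by
  rw [← (e.arrowCongr (Equiv.refl ℤˣ)).sum_comp]
  refine Finset.sum_congr rfl fun s _ => ?_
  congr 1
  simp only [signSum, Equiv.arrowCongr_apply, Equiv.coe_refl, Function.comp, id]
  exact (e.symm.sum_comp fun t => (s t : ℤ)).symm

end Signs

/-! ### Exponential square moments and tails of the walk -/

lemma sum_units_int (f : ℤˣ → ℝ) : ∑ a, f a = f 1 + f (-1) := by
  have : (univ : Finset ℤˣ) = {1, -1} := by decide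
  rw [this, Finset.sum_pair (by decide)]

/-- One step of the walk: the cross term gives a `cosh`, bounded by a Gaussian, which is absorbed by
lowering the denominator since `1/D + 2/D² ≤ 1/(D-2)`. -/
lemma exp_add_sq_average_le {D : ℝ} (hD : 2 < D) (z : ℝ) :
    Real.exp ((z + 1) ^ 2 / D) + Real.exp ((z - 1) ^ 2 / D)
      ≤ 2 * Real.exp (1 / D) * Real.exp (z ^ 2 / (D - 2)) := by
  have h := Real.cosh_le_exp_half_sq (2 * z / D)
  rw [Real.cosh_eq] at h
  have e1 : Real.exp ((z + 1) ^ 2 / D)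
      = Real.exp (1 / D) * Real.exp (z ^ 2 / D) * Real.exp (2 * z / D) := by
    rw [← Real.exp_add, ← Real.exp_add]; congr 1; ring
  have e2 : Real.exp ((z - 1) ^ 2 / D)
      = Real.exp (1 / D) * Real.exp (z ^ 2 / D) * Real.exp (-(2 * z / D)) := by
    rw [← Real.exp_add, ← Real.exp_add]; congr 1; ring
  have h3 : Real.exp (z ^ 2 / D) * Real.exp ((2 * z / D) ^ 2 / 2) ≤ Real.exp (z ^ 2 / (D - 2)) := by
    rw [← Real.exp_add, Real.exp_le_exp]
    have hk : 1 / D + 2 / D ^ 2 ≤ 1 / (D - 2) := by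
      rw [div_add_div _ _ (by positivity) (by positivity), div_le_div_iff₀ (by positivity)
        (by linarith)]
      nlinarith
    calc z ^ 2 / D + (2 * z / D) ^ 2 / 2 = z ^ 2 * (1 / D + 2 / D ^ 2) := by field_simp
      _ ≤ z ^ 2 * (1 / (D - 2)) := by gcongr
      _ = _ := by ring
  calc _ = 2 * Real.exp (1 / D) * (Real.exp (z ^ 2 / D) *
        ((Real.exp (2 * z / D) + Real.exp (-(2 * z / D))) / 2)) := by rw [e1, e2]; ring
    _ ≤ 2 * Real.exp (1 / D) * (Real.exp (z ^ 2 / D) * Real.exp ((2 * z / D) ^ 2 / 2)) := by gcongr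
    _ ≤ _ := by gcongr

/-- The denominator grows by 2 per step so that the one-step estimate closes the induction; each
step costs at most `exp (1 / b)`. -/
lemma sum_exp_sq_signSum_le_aux {b : ℝ} (hb : 0 < b) (h : ℕ) :
    ∑ s : Fin h → ℤˣ, Real.exp ((signSum s : ℝ) ^ 2 / (b + 2 * h))
      ≤ 2 ^ h * Real.exp (h / b) := by
  induction h with
  | zero => simp [signSum]
  | succ h ih =>
    rw [← (Fin.consEquiv fun _ : Fin (h + 1) => ℤˣ).sum_comp, Fintype.sum_prod_type_right]
    have hD : 2 < b + 2 * ((h + 1 : ℕ) : ℝ) := by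
      push_cast
      have : (0 : ℝ) ≤ h := by positivity
      linarith
    have hstep : ∀ s : Fin h → ℤˣ, ∑ a : ℤˣ,
        Real.exp ((signSum (Fin.consEquiv (fun _ : Fin (h + 1) => ℤˣ) (a, s)) : ℝ) ^ 2
          / (b + 2 * ((h + 1 : ℕ) : ℝ)))
        ≤ 2 * Real.exp (1 / b) * Real.exp ((signSum s : ℝ) ^ 2 / (b + 2 * h)) := by
      intro s
      have hs : ∀ a : ℤˣ, (signSum (Fin.consEquiv (fun _ : Fin (h + 1) => ℤˣ) (a, s)) : ℝ)
          = signSum s + (a : ℤ) := by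
        intro a
        simp [signSum, Fin.sum_univ_succ, Fin.consEquiv, add_comm]
      simp_rw [hs, sum_units_int]
      have := exp_add_sq_average_le hD (signSum s)
      rw [show b + 2 * ((h + 1 : ℕ) : ℝ) - 2 = b + 2 * h by push_cast; ring] at this
      simp only [Units.val_one, Int.cast_one, Units.val_neg, Int.cast_neg, ← sub_eq_add_neg]
      refine this.trans ?_
      gcongr
      have : (0 : ℝ) ≤ ((h + 1 : ℕ) : ℝ) := by positivity
      linarith
    refine (Finset.sum_le_sum fun s _ => hstep s).trans ?_
    rw [← Finset.mul_sum]
    calc _ ≤ 2 * Real.exp (1 / b) * (2 ^ h * Real.exp (h / b)) := by gcongr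
      _ = _ := by
        push_cast
        rw [add_div, Real.exp_add]; ring

/-- The exponential square moment of a simple random walk at the Gaussian scale is bounded. -/
lemma sum_exp_sq_signSum_le (h : ℕ) :
    ∑ s : Fin h → ℤˣ, Real.exp ((signSum s : ℝ) ^ 2 / (4 * h)) ≤ 2 ^ h * Real.exp (1 / 2) := by
  rcases Nat.eq_zero_or_pos h with rfl | hh
  · simp [signSum]
  · have hh' : (0 : ℝ) < h := by positivity
    have := sum_exp_sq_signSum_le_aux (b := 2 * h) (by positivity) h
    rw [show (2 * h + 2 * h : ℝ) = 4 * h by ring, show (h / (2 * h) : ℝ) = 1 / 2 by field_simp] at this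
    exact this

/-- Markov's inequality for the exponential square moment. -/
lemma card_large_signSum_le (w : ℕ) :
    (#{s : Fin w → ℤˣ | 16 * (w : ℤ) < signSum s ^ 2} : ℝ) ≤ 2 ^ w / 4 := by
  rcases Nat.eq_zero_or_pos w with rfl | hw
  · simp [signSum]
  have hw' : (0 : ℝ) < w := by positivity
  have h1 : (#{s : Fin w → ℤˣ | 16 * (w : ℤ) < signSum s ^ 2} : ℝ) * Real.exp 4
      ≤ 2 ^ w * Real.exp (1 / 2) := by
    refine le_trans ?_ (sum_exp_sq_signSum_le w)
    rw [← nsmul_eq_mul, ← Finset.sum_const]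
    refine (Finset.sum_le_sum fun s hs => ?_).trans
      (Finset.sum_le_sum_of_subset_of_nonneg (Finset.filter_subset _ _) fun s _ _ => by positivity)
    rw [Real.exp_le_exp, le_div_iff₀ (by positivity)]
    have : 16 * (w : ℤ) < signSum s ^ 2 := by simpa using hs
    have : 16 * (w : ℝ) < (signSum s : ℝ) ^ 2 := by exact_mod_cast this
    linarith
  have h2 : 4 * Real.exp (1 / 2) ≤ Real.exp 4 := by
    rw [show (4 : ℝ) = 7 / 2 + 1 / 2 by norm_num, Real.exp_add]
    have := Real.add_one_le_exp (7 / 2)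
    gcongr
    linarith
  have h3 : (0 : ℝ) < Real.exp (1 / 2) := by positivity
  rw [le_div_iff₀ (by norm_num)]
  refine le_of_mul_le_mul_right ?_ h3
  calc _ = (#{s : Fin w → ℤˣ | 16 * (w : ℤ) < signSum s ^ 2} : ℝ) * (4 * Real.exp (1 / 2)) := by ring
    _ ≤ (#{s : Fin w → ℤˣ | 16 * (w : ℤ) < signSum s ^ 2} : ℝ) * Real.exp 4 := by gcongr
    _ ≤ _ := h1

/-! ### Lower bound for the window probability -/

lemma sum_range_average_antitone {g : ℕ → ℝ} (hg : Antitone g) {q R : ℕ} (h : q ≤ R) :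
    (q + 1) * ∑ i ∈ range (R + 1), g i ≤ (R + 1) * ∑ i ∈ range (q + 1), g i := by
  induction R, h using Nat.le_induction with
  | base => exact le_rfl
  | succ R hR ih =>
    rw [Finset.sum_range_succ _ (R + 1)]
    have : (q + 1) * g (R + 1) ≤ ∑ i ∈ range (q + 1), g i := by
      have := Finset.card_nsmul_le_sum (range (q + 1)) g (g (R + 1)) fun i hi => hg (by
        have := Finset.mem_range.1 hi; omega)
      simpa using this
    push_cast
    linarith

lemma choose_add_antitone (h : ℕ) : Antitone fun i => ((2 * h).choose (h + i) : ℝ) := by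
  refine antitone_nat_of_succ_le fun i => ?_
  have e := Nat.choose_succ_right_eq (2 * h) (h + i)
  have h1 : (2 * h).choose (h + i + 1) * (h + i + 1) ≤ (2 * h).choose (h + i) * (h + i + 1) := by
    rw [e]; exact Nat.mul_le_mul_left _ (by omega)
  exact_mod_cast Nat.le_of_mul_le_mul_right h1 (by omega)

lemma card_signSum_mem_Icc (h R : ℕ) :
    (#{s : Fin (2 * h) → ℤˣ | 0 ≤ signSum s ∧ signSum s ≤ 2 * (R : ℤ)} : ℝ)
      = ∑ i ∈ range (R + 1), ((2 * h).choose (h + i) : ℝ) := by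
  rw [Finset.card_eq_sum_card_fiberwise (f := fun s => (signSum s / 2).toNat) (t := range (R + 1))]
  · push_cast
    refine Finset.sum_congr rfl fun i hi => ?_
    have := card_signSum_eq (Fin (2 * h)) (h + i)
    rw [Fintype.card_fin] at this
    rw [← this]
    congr 2
    ext s
    simp only [Finset.mem_filter, Finset.mem_univ, true_and, signSum_eq, Fintype.card_fin]
    have := Finset.mem_range.1 hi
    push_cast
    omega
  · intro s hs
    simp only [Finset.coe_filter, Finset.mem_univ, true_and, Set.mem_ofPred_eq, Finset.coe_range,
      Set.mem_Iio] at hs ⊢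
    omega

/-- Lower bound for the probability that a walk of even length ends in `[-r, r]`. -/
lemma le_walkProb {C : ℝ} (hC : 0 ≤ C) {w r : ℕ} (hw : Even w) (hr : (r : ℝ) ≤ C * √w) :
    3 / (16 * (C + 4)) * ((r + 1) / √(w + 1)) ≤ walkProb w r := by
  obtain ⟨h, rfl⟩ := even_iff_exists_two_mul.1 hw
  -- The half-width `2R` exceeds `4√w`, so the tail estimate applies; also `R ≥ r`, so the averages
  -- over the two windows can be compared; and `R = O(√w)`.
  set R := ⌈(C + 2) * √((2 * h : ℕ) : ℝ)⌉₊ with hRdef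
  have hR : (C + 2) * √((2 * h : ℕ) : ℝ) ≤ R := Nat.le_ceil _
  have hs0 : 0 ≤ √((2 * h : ℕ) : ℝ) := Real.sqrt_nonneg _
  have hR' : (R : ℝ) ≤ (C + 2) * √((2 * h : ℕ) : ℝ) + 1 := (Nat.ceil_lt_add_one (by positivity)).le
  have hqR : r / 2 ≤ R := by
    have : (r : ℝ) ≤ R := hr.trans (le_trans (by nlinarith) hR)
    have : r ≤ R := by exact_mod_cast this
    omega
  -- mass of the large window
  have hbig : (3 : ℝ) / 8 * 2 ^ (2 * h) ≤ ∑ i ∈ range (R + 1), ((2 * h).choose (h + i) : ℝ) := by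
    rw [← card_signSum_mem_Icc]
    have h1 := card_large_signSum_le (2 * h)
    have hneg : #{s : Fin (2 * h) → ℤˣ | -(2 * (R : ℤ)) ≤ signSum s ∧ signSum s ≤ 0}
        = #{s : Fin (2 * h) → ℤˣ | 0 ≤ signSum s ∧ signSum s ≤ 2 * (R : ℤ)} := by
      refine Finset.card_equiv (Equiv.neg _) fun s => ?_
      simp only [Finset.mem_filter, Finset.mem_univ, true_and, Equiv.neg_apply, signSum_neg]
      omega
    -- The tail has mass at most 1/4 and the two half-windows have equal mass, so each has at least
    -- 3/8.
    have hcover : (univ : Finset (Fin (2 * h) → ℤˣ)) ⊆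
        (({s | 16 * ((2 * h : ℕ) : ℤ) < signSum s ^ 2} : Finset _) ∪
        ({s | -(2 * (R : ℤ)) ≤ signSum s ∧ signSum s ≤ 0} : Finset _)) ∪
        ({s | 0 ≤ signSum s ∧ signSum s ≤ 2 * (R : ℤ)} : Finset _) := by
      intro s _
      simp only [Finset.mem_union, Finset.mem_filter, Finset.mem_univ, true_and]
      by_cases hl : 16 * ((2 * h : ℕ) : ℤ) < signSum s ^ 2
      · exact Or.inl (Or.inl hl)
      · have h2 : (signSum s : ℝ) ^ 2 ≤ 16 * ((2 * h : ℕ) : ℝ) := by exact_mod_cast not_lt.1 hl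
        have h3 : |(signSum s : ℝ)| ≤ 2 * R := by
          refine abs_le_of_sq_le_sq ?_ (by positivity)
          have h4 : 2 * √((2 * h : ℕ) : ℝ) ≤ R := le_trans (by nlinarith) hR
          have h5 := Real.sq_sqrt (show (0 : ℝ) ≤ ((2 * h : ℕ) : ℝ) by positivity)
          nlinarith
        have h6 : |signSum s| ≤ 2 * (R : ℤ) := by exact_mod_cast h3
        rw [abs_le] at h6
        omega
    have hcard := (Finset.card_le_card hcover).trans
      ((Finset.card_union_le _ _).trans (Nat.add_le_add_right (Finset.card_union_le _ _) _))
    rw [hneg] at hcard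
    have hc : (#(univ : Finset (Fin (2 * h) → ℤˣ))) = 2 ^ (2 * h) := by
      simp [Fintype.card_units_int]
    rw [hc] at hcard
    have hcard' : (2 : ℝ) ^ (2 * h) ≤ (#{s : Fin (2 * h) → ℤˣ | 16 * ((2 * h : ℕ) : ℤ) < signSum s ^ 2} : ℝ)
        + #{s : Fin (2 * h) → ℤˣ | 0 ≤ signSum s ∧ signSum s ≤ 2 * (R : ℤ)}
        + #{s : Fin (2 * h) → ℤˣ | 0 ≤ signSum s ∧ signSum s ≤ 2 * (R : ℤ)} := by
      exact_mod_cast hcard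
    linarith
  -- Even-length walks sit at even positions `2 * i`; those with `0 ≤ i ≤ r / 2` lie in the window.
  have hsmall : ∑ i ∈ range (r / 2 + 1), ((2 * h).choose (h + i) : ℝ)
      ≤ ∑ s : Fin (2 * h) → ℤˣ, windowInd r (signSum s) := by
    rw [← card_signSum_mem_Icc, Finset.card_filter]
    push_cast
    refine Finset.sum_le_sum fun s _ => ?_
    rw [windowInd]
    split_ifs with h1 h2 h2
    · exact le_rfl
    · exact absurd (abs_le.2 ⟨by omega, by omega⟩) h2
    · exact zero_le_one
    · exact le_rfl
  have havg := sum_range_average_antitone (choose_add_antitone h) hqR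
  have hq : ((r : ℝ) + 1) / 2 ≤ ((r / 2 : ℕ) : ℝ) + 1 := by
    have : r + 1 ≤ 2 * (r / 2 + 1) := by omega
    have : (r : ℝ) + 1 ≤ 2 * (((r / 2 : ℕ) : ℝ) + 1) := by exact_mod_cast this
    linarith
  have hsq : √((2 * h : ℕ) : ℝ) ≤ √(((2 * h : ℕ) : ℝ) + 1) := Real.sqrt_le_sqrt (by linarith)
  have hsq1 : 1 ≤ √(((2 * h : ℕ) : ℝ) + 1) := by
    rw [Real.one_le_sqrt]
    have : (0 : ℝ) ≤ ((2 * h : ℕ) : ℝ) := by positivity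
    linarith
  have hRsq : (R : ℝ) + 1 ≤ (C + 4) * √(((2 * h : ℕ) : ℝ) + 1) := by nlinarith
  rw [walkProb, le_div_iff₀ (by positivity)]
  set Y := √(((2 * h : ℕ) : ℝ) + 1)
  set X := ∑ s : Fin (2 * h) → ℤˣ, windowInd r (signSum s)
  have hX : 0 ≤ X := Finset.sum_nonneg fun s _ => windowInd_nonneg _ _
  have hfin : ((r : ℝ) + 1) / 2 * (3 / 8 * 2 ^ (2 * h)) ≤ ((C + 4) * Y) * X := by
    calc _ ≤ (((r / 2 : ℕ) : ℝ) + 1) * ∑ i ∈ range (R + 1), ((2 * h).choose (h + i) : ℝ) := by gcongr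
      _ ≤ _ := havg
      _ ≤ _ := by gcongr
  have hY : 0 < Y := by linarith
  rw [div_mul_div_comm, div_mul_eq_mul_div, div_le_iff₀ (by positivity)]
  linarith

/-! ### Joint anti-concentration of two correlated walks -/

lemma signSum_eq_add_subtype {ι : Type*} [Fintype ι] (p : ι → Prop) [DecidablePred p]
    (s : ι → ℤˣ) : signSum s
      = signSum (fun t : {t // p t} => s t) + signSum (fun t : {t // ¬ p t} => s t) := by
  simp only [signSum]
  exact (Fintype.sum_subtype_add_sum_subtype p fun t => (s t : ℤ)).symm

lemma signSum_mul_eq_sub {ι : Type*} [Fintype ι] (x s : ι → ℤˣ) [DecidablePred fun t => x t = 1] :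
    signSum (s * x) = signSum (fun t : {t // x t = 1} => s t)
      - signSum (fun t : {t // ¬ x t = 1} => s t) := by
  rw [signSum_eq_add_subtype (fun t => x t = 1), sub_eq_add_neg, ← signSum_neg]
  congr 2
  · ext t; simp [t.2]
  · ext t
    have : x t = -1 := (Int.units_eq_one_or (x t)).resolve_left t.2
    simp [this]

/-- Since `2a` and `2b` are the sum and difference of `a + b` and `a - b`, the joint event decouples
into events on disjoint sets of steps. -/
lemma windowInd_add_mul_sub_le (r : ℕ) (a b : ℤ) :
    windowInd r (a + b) * windowInd r (a - b) ≤ windowInd r a * windowInd r b := by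
  simp only [windowInd, ite_zero_mul_ite_zero, mul_one]
  by_cases h : |a + b| ≤ r ∧ |a - b| ≤ r
  · rw [if_pos h, if_pos]
    rw [abs_le, abs_le] at h ⊢
    omega
  · rw [if_neg h]
    split_ifs <;> norm_num

lemma one_div_sqrt_mul_le {x y : ℝ} (hx : 0 < x) (hy : 0 < y) :
    1 / √x * (1 / √y) ≤ (1 / x + 1 / y) / 2 := by
  have h := two_mul_le_add_sq (1 / √x) (1 / √y)
  rw [div_pow, div_pow, Real.sq_sqrt hx.le, Real.sq_sqrt hy.le] at h
  linarith

/-- With `a`, `b` the partial sums over `x = 1` and `x = -1`, the walks end at `a + b` and `a - b`;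
decouple and bound each factor by its point probabilities. AM-GM replaces the square roots by
reciprocals, whose binomial averages are explicit. -/
lemma sum_windowInd_mul_windowInd_le {w r : ℕ} (x : Fin w → ℤˣ) :
    ∑ s : Fin w → ℤˣ, windowInd r (signSum s) * windowInd r (signSum (s * x))
      ≤ 2 * (r + 1) ^ 2 * 2 ^ w * (1 / ((#(signEquivFinset _ x) : ℝ) + 1)
        + 1 / (((w - #(signEquivFinset _ x) : ℕ) : ℝ) + 1)) := by
  classical
  have hle : ∑ s : Fin w → ℤˣ, windowInd r (signSum s) * windowInd r (signSum (s * x))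
      ≤ (∑ a : {t // x t = 1} → ℤˣ, windowInd r (signSum a)) *
        ∑ b : {t // ¬ x t = 1} → ℤˣ, windowInd r (signSum b) := by
    rw [Fintype.sum_mul_sum, ← Fintype.sum_prod_type',
      ← (Equiv.piEquivPiSubtypeProd (fun t => x t = 1) fun _ => ℤˣ).sum_comp]
    refine Finset.sum_le_sum fun s _ => ?_
    rw [signSum_mul_eq_sub, signSum_eq_add_subtype (fun t => x t = 1)]
    exact windowInd_add_mul_sub_le _ _ _
  have hk : Fintype.card {t // x t = 1} = #(signEquivFinset _ x) := by
    rw [Fintype.card_subtype]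
    simp [signEquivFinset]
  have hk' : Fintype.card {t // ¬ x t = 1} = w - #(signEquivFinset _ x) := by
    rw [Fintype.card_subtype_compl, hk, Fintype.card_fin]
  have hkw : #(signEquivFinset _ x) ≤ w := by simpa using Finset.card_le_univ (signEquivFinset _ x)
  have h1 := sum_windowInd_le {t // x t = 1} r
  have h2 := sum_windowInd_le {t // ¬ x t = 1} r
  rw [hk] at h1
  rw [hk'] at h2
  generalize #(signEquivFinset _ x) = k at *
  have hpow : (2 : ℝ) ^ w = 2 ^ k * 2 ^ (w - k) := by rw [← pow_add, Nat.add_sub_cancel' hkw]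
  refine hle.trans ((mul_le_mul h1 h2 (Finset.sum_nonneg fun _ _ => windowInd_nonneg _ _)
    (by positivity)).trans ?_)
  have := one_div_sqrt_mul_le (x := (k : ℝ) + 1) (y := ((w - k : ℕ) : ℝ) + 1) (by positivity)
    (by positivity)
  calc _ = 4 * (r + 1) ^ 2 * 2 ^ w * (1 / √((k : ℝ) + 1) * (1 / √(((w - k : ℕ) : ℝ) + 1))) := by
        rw [hpow]; ring
    _ ≤ 4 * (r + 1) ^ 2 * 2 ^ w * ((1 / ((k : ℝ) + 1) + 1 / (((w - k : ℕ) : ℝ) + 1)) / 2) := by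
        gcongr
    _ = _ := by ring

/-- Absorbing `1/(k+1)` by `(w+1) C(w,k) = (k+1) C(w+1,k+1)` leaves the expansion of `(b + (1 - b))
^ (w + 1)` without its zeroth term. -/
lemma sum_choose_div_succ_le (w : ℕ) {b : ℝ} (hb : 0 < b) (hb1 : b ≤ 1) :
    ∑ k ∈ range (w + 1), (w.choose k : ℝ) * (b ^ k * (1 - b) ^ (w - k)) * (1 / ((k : ℝ) + 1))
      ≤ 1 / (b * (w + 1)) := by
  rw [le_div_iff₀ (by positivity), Finset.sum_mul]
  have hbin := add_pow b (1 - b) (w + 1)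
  rw [add_sub_cancel, one_pow, Finset.sum_range_succ'] at hbin
  have h0 : 0 ≤ b ^ 0 * (1 - b) ^ (w + 1 - 0) * ((w + 1).choose 0 : ℝ) := by
    have : 0 ≤ 1 - b := by linarith
    positivity
  refine le_trans (le_of_eq ?_) (le_trans (le_add_of_nonneg_right h0) hbin.symm.le)
  refine Finset.sum_congr rfl fun k _ => ?_
  have e : ((w : ℝ) + 1) * w.choose k = (w + 1).choose (k + 1) * (k + 1) := by
    exact_mod_cast Nat.add_one_mul_choose_eq w k
  rw [Nat.succ_sub_succ, pow_succ]
  field_simp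
  linear_combination (1 - b) ^ (w - k) * e

/-- Two walks whose steps are correlated but not degenerate are jointly anti-concentrated. -/
lemma pairProb_le (w r : ℕ) {b : ℝ} (hb : 0 < b) (hb1 : b < 1) :
    pairProb w r (2 * b - 1) ≤ 2 * (1 / b + 1 / (1 - b)) * ((r + 1) ^ 2 / (w + 1)) := by
  -- Put `s' = s * x`: the signs of `x` record agreement of steps, and are independent of `s` and
  -- equal to 1 with probability `b`.
  have hsubst : pairProb w r (2 * b - 1) = ∑ x : Fin w → ℤˣ,
      (∏ t, ((1 + (2 * b - 1) * ((x t : ℤ) : ℝ)) / 4)) *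
        ∑ s : Fin w → ℤˣ, windowInd r (signSum s) * windowInd r (signSum (s * x)) := by
    rw [pairProb]
    simp_rw [Finset.mul_sum]
    conv_rhs => rw [Finset.sum_comm]
    refine Finset.sum_congr rfl fun s _ => ?_
    rw [← Equiv.sum_comp (Equiv.mulLeft s)]
    refine Finset.sum_congr rfl fun x _ => ?_
    rw [Equiv.coe_mulLeft, mul_comm]
    congr 1
    refine Finset.prod_congr rfl fun t _ => ?_
    have := unit_sq_cast (s t)
    simp only [Pi.mul_apply, Units.val_mul, Int.cast_mul]
    linear_combination ((2 * b - 1) * ((x t : ℤ) : ℝ) / 4) * this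
  have hprod : ∀ x : Fin w → ℤˣ, ∏ t, ((1 + (2 * b - 1) * ((x t : ℤ) : ℝ)) / 4)
      = b ^ #(signEquivFinset _ x) * (1 - b) ^ (w - #(signEquivFinset _ x)) / 2 ^ w := by
    classical
    intro x
    have h : ∀ t, (1 + (2 * b - 1) * ((x t : ℤ) : ℝ)) / 4 = (if x t = 1 then b else 1 - b) / 2 := by
      intro t
      rcases Int.units_eq_one_or (x t) with h | h
      · simp [h]; ring
      · simp [h]; ring
    have hc : #{t | x t = 1} = #(signEquivFinset _ x) := by simp [signEquivFinset]
    have hc' : #{t | ¬ x t = 1} = w - #(signEquivFinset _ x) := by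
      have := Finset.card_filter_add_card_filter_not (s := (univ : Finset (Fin w))) fun t => x t = 1
      rw [Finset.card_univ, Fintype.card_fin] at this
      omega
    simp_rw [h]
    rw [Finset.prod_div_distrib, Finset.prod_ite, Finset.prod_const, Finset.prod_const, hc, hc']
    simp
  have h1b : 0 < 1 - b := by linarith
  rw [hsubst]
  have hbound : ∀ x : Fin w → ℤˣ, (∏ t, ((1 + (2 * b - 1) * ((x t : ℤ) : ℝ)) / 4)) *
      ∑ s : Fin w → ℤˣ, windowInd r (signSum s) * windowInd r (signSum (s * x))
      ≤ 2 * (r + 1) ^ 2 * (fun k : ℕ => b ^ k * (1 - b) ^ (w - k) * (1 / ((k : ℝ) + 1)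
        + 1 / (((w - k : ℕ) : ℝ) + 1))) #(signEquivFinset _ x) := by
    intro x
    rw [hprod]
    refine (mul_le_mul_of_nonneg_left (sum_windowInd_mul_windowInd_le x) (by positivity)).trans
      (le_of_eq ?_)
    field_simp
  refine (Finset.sum_le_sum fun x _ => hbound x).trans ?_
  rw [← Finset.mul_sum, (signEquivFinset (Fin w)).sum_comp fun S => (fun k : ℕ =>
    b ^ k * (1 - b) ^ (w - k) * (1 / ((k : ℝ) + 1) + 1 / (((w - k : ℕ) : ℝ) + 1))) #S,
    ← Finset.powerset_univ, Finset.sum_powerset_apply_card (fun k : ℕ =>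
    b ^ k * (1 - b) ^ (w - k) * (1 / ((k : ℝ) + 1) + 1 / (((w - k : ℕ) : ℝ) + 1))),
    Finset.card_univ, Fintype.card_fin]
  have hsum : ∑ k ∈ range (w + 1), w.choose k •
      (b ^ k * (1 - b) ^ (w - k) * (1 / ((k : ℝ) + 1) + 1 / (((w - k : ℕ) : ℝ) + 1)))
      ≤ 1 / (b * (w + 1)) + 1 / ((1 - b) * (w + 1)) := by
    refine le_trans (le_of_eq ?_) (add_le_add (sum_choose_div_succ_le w hb hb1.le)
      (sum_choose_div_succ_le w h1b (by linarith)))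
    -- Reflecting `k ↦ w - k` exchanges `b` with `1 - b`.
    rw [← Finset.sum_flip (fun k => (w.choose k : ℝ) * ((1 - b) ^ k * (1 - (1 - b)) ^ (w - k)) *
      (1 / ((k : ℝ) + 1))), ← Finset.sum_add_distrib]
    refine Finset.sum_congr rfl fun k hk => ?_
    have hk' : k ≤ w := Nat.lt_succ_iff.1 (Finset.mem_range.1 hk)
    rw [Nat.choose_symm hk', Nat.sub_sub_self hk', nsmul_eq_mul]
    ring
  refine (mul_le_mul_of_nonneg_left hsum (by positivity)).trans (le_of_eq ?_)
  field_simp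

/-! ### Weak and quadratic bounds for one row -/

/-- The constant of the weak bound. -/
noncomputable def weakConst (C δ : ℝ) : ℝ :=
  2 * (1 / (1 - δ) + 1 / δ) * (16 * (C + 4) / 3) ^ 2

lemma weakConst_pos {C δ : ℝ} (hC : 0 ≤ C) (h0 : 0 < δ) (h1 : δ < 1 / 2) : 0 < weakConst C δ := by
  have : 0 < 1 - δ := by linarith
  unfold weakConst
  positivity

lemma walkProb_nonneg (w r : ℕ) : 0 ≤ walkProb w r :=
  div_nonneg (Finset.sum_nonneg fun _ _ => windowInd_nonneg _ _) (by positivity)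

lemma pairProb_endpoint_le {C δ : ℝ} (hC : 0 ≤ C) (h0 : 0 < δ) (h1 : δ < 1 / 2) {w r : ℕ}
    (hw : Even w) (hr : (r : ℝ) ≤ C * √w) :
    pairProb w r (1 - 2 * δ) ≤ weakConst C δ * walkProb w r ^ 2 := by
  have hu := pairProb_le w r (b := 1 - δ) (by linarith) (by linarith)
  have hl := le_walkProb hC hw hr
  have hl' : ((r : ℝ) + 1) / √(w + 1) ≤ 16 * (C + 4) / 3 * walkProb w r := by
    rw [div_mul_eq_mul_div, div_le_iff₀ (by positivity)] at hl
    linarith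
  rw [show 2 * (1 - δ) - 1 = 1 - 2 * δ by ring, sub_sub_cancel] at hu
  have h1' : 0 < 1 - δ := by linarith
  refine hu.trans ?_
  have hsq : ((r : ℝ) + 1) ^ 2 / (w + 1) = (((r : ℝ) + 1) / √(w + 1)) ^ 2 := by
    rw [div_pow, Real.sq_sqrt (by positivity)]
  rw [hsq, weakConst, mul_assoc _ _ (walkProb w r ^ 2), ← mul_pow]
  gcongr

lemma pairProb_le_quadratic {C δ : ℝ} (hC : 0 ≤ C) (h0 : 0 < δ) (h1 : δ < 1 / 2) {w r : ℕ}
    (hw : Even w) (hr : (r : ℝ) ≤ C * √w) {ρ : ℝ} (hρ : |ρ| ≤ 1 - 2 * δ) :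
    pairProb w r ρ ≤ (1 + weakConst C δ / (1 - 2 * δ) ^ 2 * ρ ^ 2) * walkProb w r ^ 2 := by
  have hd : 0 < 1 - 2 * δ := by linarith
  have ha := pairProb_sub_le (w := w) (r := r) hd hρ
  have hb := pairProb_endpoint_le hC h0 h1 hw hr
  have hc : (ρ / (1 - 2 * δ)) ^ 2 * (pairProb w r (1 - 2 * δ) - walkProb w r ^ 2)
      ≤ (ρ / (1 - 2 * δ)) ^ 2 * (weakConst C δ * walkProb w r ^ 2) := by
    gcongr
    have := sq_nonneg (walkProb w r)
    linarith
  have hd' : (ρ / (1 - 2 * δ)) ^ 2 * (weakConst C δ * walkProb w r ^ 2)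
      = weakConst C δ / (1 - 2 * δ) ^ 2 * ρ ^ 2 * walkProb w r ^ 2 := by
    rw [div_pow]; ring
  linarith

/-- The excess at `ρ` is at most the excess at the endpoint, so the endpoint constant serves for all
smaller `|ρ|`. -/
lemma pairProb_le_weakConst {C δ : ℝ} (hC : 0 ≤ C) (h0 : 0 < δ) (h1 : δ < 1 / 2) {w r : ℕ}
    (hw : Even w) (hr : (r : ℝ) ≤ C * √w) {ρ : ℝ} (hρ : |ρ| ≤ 1 - 2 * δ) :
    pairProb w r ρ ≤ weakConst C δ * walkProb w r ^ 2 := by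
  have hd : 0 < 1 - 2 * δ := by linarith
  have ha := pairProb_sub_le (w := w) (r := r) hd hρ
  have hb := pairProb_endpoint_le hC h0 h1 hw hr
  have hnn := sq_walkProb_le_pairProb w r (1 - 2 * δ)
  have hle : (ρ / (1 - 2 * δ)) ^ 2 ≤ 1 := by
    rw [div_pow, div_le_one (by positivity), ← sq_abs ρ]
    gcongr
  have := mul_le_mul_of_nonneg_right hle (sub_nonneg.2 hnn)
  linarith

/-! ### Overlaps and the moments of `Z` -/

/-- The normalized inner product of two vectors. -/
noncomputable def overlap {n : ℕ} (u v : Fin n → ℤ) : ℝ := (∑ j, (u j : ℝ) * v j) / n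

lemma balanced_eq_image (n : ℕ) : balanced n =
    ({s : Fin n → ℤˣ | signSum s = 0} : Finset _).image fun s j => (s j : ℤ) := by
  ext u
  simp only [mem_balanced_iff, Finset.mem_image, Finset.mem_filter, Finset.mem_univ, true_and]
  exact exists_congr fun s => and_congr_right fun _ => eq_comm

lemma coe_signs_injective (n : ℕ) : Function.Injective fun (s : Fin n → ℤˣ) j => (s j : ℤ) :=
  fun _ _ h => funext fun j => Units.ext (congrFun h j)

lemma sum_balanced {n : ℕ} (f : (Fin n → ℤ) → ℝ) :
    ∑ u ∈ balanced n, f u = ∑ s : Fin n → ℤˣ with signSum s = 0, f fun j => (s j : ℤ) := by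
  rw [balanced_eq_image, Finset.sum_image (coe_signs_injective n).injOn]

lemma card_balanced (h : ℕ) : #(balanced (2 * h)) = h.centralBinom := by
  rw [balanced_eq_image, Finset.card_image_of_injective _ (coe_signs_injective _),
    Nat.centralBinom_eq_two_mul_choose]
  have := card_signSum_eq (Fin (2 * h)) h
  simpa using this

lemma agreement_eq_overlap {n : ℕ} (hn : 0 < n) {u v : Fin n → ℤ} (hu : u ∈ balanced n)
    (hv : v ∈ balanced n) : agreement u v = (1 + overlap u v) / 2 := by
  obtain ⟨s, -, rfl⟩ := mem_balanced_iff.1 hu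
  obtain ⟨s', -, rfl⟩ := mem_balanced_iff.1 hv
  have h : ∀ j, ((s j : ℤ) : ℝ) * (s' j : ℤ) = 2 * (if (s j : ℤ) = s' j then 1 else 0) - 1 := by
    intro j
    rcases Int.units_eq_one_or (s j) with h | h <;> rcases Int.units_eq_one_or (s' j) with h' | h' <;>
      simp only [h, h'] <;> norm_num
  have : (n : ℝ) ≠ 0 := by positivity
  rw [agreement, overlap, Finset.sum_congr rfl fun j _ => h j, Finset.sum_sub_distrib,
    ← Finset.mul_sum, Finset.sum_boole]
  simp only [Finset.sum_const, Finset.card_univ, Fintype.card_fin, nsmul_eq_mul, mul_one]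
  field_simp
  ring

section Moments

variable {m n : ℕ} {lam : ℝ≥0} {w r : Fin m → ℕ}

/-- A general `I` covers both uses: a singleton gives `φ_i`, all rows give the moments; `u = v`
gives `ψ_i` and the first moment. -/
lemma prob_forall_mem_goodSet (hn : 0 < n) (hl : 0 < lam) {u v : Fin n → ℤ}
    (hu : u ∈ balanced n) (hv : v ∈ balanced n) (I : Finset (Fin m)) :
    (condPoissonEnsemble m n lam w).real
      {A | ∀ i ∈ I, u ∈ goodSet (window r) A i ∧ v ∈ goodSet (window r) A i}
      = ∏ i ∈ I, pairProb (w i) (r i) (overlap u v) := by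
  classical
  have h := condPoissonEnsemble_real_forall hn hl w fun i => if i ∈ I then
    {a | ∑ j, u j * (a j : ℤ) ∈ Set.Icc (-(r i : ℤ)) (r i) ∧
      ∑ j, v j * (a j : ℤ) ∈ Set.Icc (-(r i : ℤ)) (r i)} else Set.univ
  have hset : {A : Fin m → Fin n → ℕ | ∀ i ∈ I, u ∈ goodSet (window r) A i ∧
      v ∈ goodSet (window r) A i} = {A | ∀ i, A i ∈ if i ∈ I then
    {a : Fin n → ℕ | ∑ j, u j * (a j : ℤ) ∈ Set.Icc (-(r i : ℤ)) (r i) ∧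
      ∑ j, v j * (a j : ℤ) ∈ Set.Icc (-(r i : ℤ)) (r i)} else Set.univ} := by
    ext A
    refine forall_congr' fun i => ?_
    by_cases hi : i ∈ I <;> simp [hi, goodSet, hu, hv, window, rowInner]
  rw [hset, h, ← Finset.prod_subset (Finset.subset_univ I)]
  · refine Finset.prod_congr rfl fun i hi => ?_
    rw [if_pos hi]
    exact rowProb_window_pair hn _ _ hu hv
  · intro i _ hi
    rw [if_neg hi, rowProb_univ hn]

lemma overlap_self {u : Fin n → ℤ} (hn : 0 < n) (hu : u ∈ balanced n) : overlap u u = 1 := by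
  obtain ⟨s, -, rfl⟩ := mem_balanced_iff.1 hu
  have : (n : ℝ) ≠ 0 := by positivity
  simp [overlap, unit_sq_cast, this]

lemma pairProb_one_eq (hn : 0 < n) {u : Fin n → ℤ} (hu : u ∈ balanced n) (w r : ℕ) :
    pairProb w r 1 = walkProb w r := by
  rw [← overlap_self hn hu, overlap, ← rowProb_window_pair hn w r hu hu, ← rowProb_window hn w r hu]
  simp

lemma phi_eq_pairProb (hn : 0 < n) (hl : 0 < lam) {u v : Fin n → ℤ} (hu : u ∈ balanced n)
    (hv : v ∈ balanced n) (i : Fin m) :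
    phi (condPoissonEnsemble m n lam w) (window r) i u v
      = pairProb (w i) (r i) (overlap u v) := by
  simpa [phi] using prob_forall_mem_goodSet (w := w) (r := r) hn hl hu hv {i}

lemma psi_eq_walkProb (hn : 0 < n) (hl : 0 < lam) {u : Fin n → ℤ} (hu : u ∈ balanced n)
    (i : Fin m) :
    psi (condPoissonEnsemble m n lam w) (window r) i u = walkProb (w i) (r i) := by
  rw [← pairProb_one_eq hn hu, ← overlap_self hn hu, ← phi_eq_pairProb hn hl hu hu]
  simp [phi, psi]

lemma pairProb_overlap_le_walkProb (hn : 0 < n) {u v : Fin n → ℤ}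
    (hu : u ∈ balanced n) (hv : v ∈ balanced n) (w r : ℕ) :
    pairProb w r (overlap u v) ≤ walkProb w r := by
  rw [overlap, ← rowProb_window_pair hn w r hu hv, ← rowProb_window hn w r hu, rowProb, rowProb]
  gcongr with s
  exact fun h => h.1

lemma numSolutions_eq_sum (K : Fin m → Set ℤ) (A : Fin m → Fin n → ℕ) :
    (numSolutions K A : ℝ)
      = ∑ u ∈ balanced n, {A : Fin m → Fin n → ℕ | ∀ i, u ∈ goodSet K A i}.indicator 1 A := by
  classical
  rw [numSolutions, Finset.card_filter]
  push_cast
  refine Finset.sum_congr rfl fun u _ => ?_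
  simp [Set.indicator_apply]

lemma isProbabilityMeasure_condPoissonEnsemble (hn : 0 < n) (hl : 0 < lam) :
    IsProbabilityMeasure (condPoissonEnsemble m n lam w) := by
  have h := condPoissonEnsemble_real_forall hn hl w fun _ => Set.univ
  simp only [Set.mem_univ, implies_true, Set.ofPred_true, rowProb_univ hn, Finset.prod_const_one] at h
  refine ⟨?_⟩
  rw [measureReal_def] at h
  exact (ENNReal.toReal_eq_one_iff _).1 h

lemma momentZ_one (hn : 0 < n) (hl : 0 < lam) :
    momentZ (condPoissonEnsemble m n lam w) (window r) 1
      = #(balanced n) * ∏ i, walkProb (w i) (r i) := by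
  have := isProbabilityMeasure_condPoissonEnsemble (w := w) hn hl
  simp_rw [momentZ, pow_one, numSolutions_eq_sum]
  rw [integral_finsetSum]
  · rw [← nsmul_eq_mul, ← Finset.sum_const]
    refine Finset.sum_congr rfl fun u hu => ?_
    rw [integral_indicator_one MeasurableSet.of_discrete]
    have := prob_forall_mem_goodSet (w := w) (r := r) hn hl hu hu univ
    simpa [overlap_self hn hu, pairProb_one_eq hn hu] using this
  · intro u _
    exact (integrable_const (1 : ℝ)).indicator MeasurableSet.of_discrete

lemma momentZ_two (hn : 0 < n) (hl : 0 < lam) :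
    momentZ (condPoissonEnsemble m n lam w) (window r) 2
      = ∑ u ∈ balanced n, ∑ v ∈ balanced n, ∏ i, pairProb (w i) (r i) (overlap u v) := by
  have := isProbabilityMeasure_condPoissonEnsemble (w := w) hn hl
  simp_rw [momentZ, numSolutions_eq_sum, sq, Finset.sum_mul_sum, ← Set.inter_indicator_mul]
  have hint : ∀ u v : Fin n → ℤ, Integrable (({A : Fin m → Fin n → ℕ |
      ∀ i, u ∈ goodSet (window r) A i} ∩ {A | ∀ i, v ∈ goodSet (window r) A i}).indicator
      fun x => (1 : (Fin m → Fin n → ℕ) → ℝ) x * (1 : (Fin m → Fin n → ℕ) → ℝ) x)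
      (condPoissonEnsemble m n lam w) := by
    intro u v
    simp only [Pi.one_apply, mul_one]
    exact (integrable_const (1 : ℝ)).indicator MeasurableSet.of_discrete
  rw [integral_finsetSum _ fun u _ => integrable_finsetSum _ fun v _ => hint u v]
  refine Finset.sum_congr rfl fun u hu => ?_
  rw [integral_finsetSum _ fun v _ => hint u v]
  refine Finset.sum_congr rfl fun v hv => ?_
  have h := prob_forall_mem_goodSet (w := w) (r := r) hn hl hu hv univ
  rw [← h]
  simp only [Pi.one_apply, mul_one]
  refine (integral_indicator_one MeasurableSet.of_discrete).trans ?_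
  congr 1
  ext A
  simp [forall_and]

lemma sq_momentZ_one_le_momentZ_two (hn : 0 < n) (hl : 0 < lam) :
    momentZ (condPoissonEnsemble m n lam w) (window r) 1 ^ 2
      ≤ momentZ (condPoissonEnsemble m n lam w) (window r) 2 := by
  rw [momentZ_one hn hl, momentZ_two hn hl]
  have : ∀ u ∈ balanced n, ∀ v ∈ balanced n, (∏ i, walkProb (w i) (r i)) ^ 2
      ≤ ∏ i, pairProb (w i) (r i) (overlap u v) := by
    intro u _ v _
    rw [← Finset.prod_pow]
    exact Finset.prod_le_prod (fun i _ => sq_nonneg _) fun i _ => sq_walkProb_le_pairProb _ _ _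
  refine le_trans (le_of_eq ?_)
    (Finset.sum_le_sum fun u hu => Finset.sum_le_sum fun v hv => this u hu v hv)
  simp only [Finset.sum_const, nsmul_eq_mul]
  ring

end Moments

/-! ### Distribution of the overlap -/

/-- The overlap is `a / h`, with `a` the sum of `v` over the positive half of `u`. Balance forces
the other half to sum to `-a`; the point bound for that half, divided by the number of balanced
vectors, costs a factor at most 2 against a free `h`-step walk. -/
lemma sum_balanced_exp_overlap_sq_le {h : ℕ} (hh : 1 ≤ h) {u : Fin (2 * h) → ℤ}
    (hu : u ∈ balanced (2 * h)) :
    ∑ v ∈ balanced (2 * h), Real.exp (h * overlap u v ^ 2 / 4)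
      ≤ 2 * Real.exp (1 / 2) * #(balanced (2 * h)) := by
  classical
  obtain ⟨x, hx, rfl⟩ := mem_balanced_iff.1 hu
  have hh' : (0 : ℝ) < h := by positivity
  have hc : Fintype.card {t // x t = 1} = h := by
    have := signSum_eq x
    rw [hx, Fintype.card_fin] at this
    have h2 : Fintype.card {t // x t = 1} = #(signEquivFinset _ x) := by
      rw [Fintype.card_subtype]; simp [signEquivFinset]
    omega
  have hc' : Fintype.card {t // ¬ x t = 1} = h := by
    rw [Fintype.card_subtype_compl, hc, Fintype.card_fin]; omega
  have hov : ∀ s : Fin (2 * h) → ℤˣ, signSum s = 0 →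
      overlap (fun j => (x j : ℤ)) (fun j => (s j : ℤ))
        = (signSum fun t : {t // x t = 1} => s t) / h := by
    intro s hs
    have h1 := signSum_mul_eq_sub x s
    have h2 := signSum_eq_add_subtype (fun t => x t = 1) s
    have h3 : ∑ j, ((x j : ℤ) : ℝ) * (s j : ℤ) = (signSum (s * x) : ℝ) := by
      simp [signSum, mul_comm]
    have h4 : signSum (s * x) = 2 * signSum fun t : {t // x t = 1} => s t := by omega
    rw [overlap, h3, h4]
    push_cast
    field_simp
  rw [sum_balanced, Finset.sum_filter]
  have hterm : ∀ s : Fin (2 * h) → ℤˣ, (if signSum s = 0 then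
      Real.exp (h * overlap (fun j => (x j : ℤ)) (fun j => (s j : ℤ)) ^ 2 / 4) else 0)
      = (fun p : ({t // x t = 1} → ℤˣ) × ({t // ¬ x t = 1} → ℤˣ) =>
        Real.exp ((signSum p.1 : ℝ) ^ 2 / (4 * h)) * if signSum p.2 = -signSum p.1 then 1 else 0)
        (Equiv.piEquivPiSubtypeProd (fun t => x t = 1) (fun _ => ℤˣ) s) := by
    intro s
    have h2 := signSum_eq_add_subtype (fun t => x t = 1) s
    by_cases hs : signSum s = 0
    · simp only [hs, if_true, hov s hs, Equiv.piEquivPiSubtypeProd]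
      simp only [Equiv.coe_fn_mk]
      rw [if_pos (by omega), mul_one]
      congr 1
      field_simp
    · simp only [hs, if_false, Equiv.piEquivPiSubtypeProd]
      simp only [Equiv.coe_fn_mk]
      rw [if_neg (by omega), mul_zero]
  refine (Finset.sum_congr rfl fun s _ => hterm s).trans_le ?_
  refine (Equiv.sum_comp (Equiv.piEquivPiSubtypeProd (fun t => x t = 1) fun _ => ℤˣ)
    fun p : ({t // x t = 1} → ℤˣ) × ({t // ¬ x t = 1} → ℤˣ) =>
    Real.exp ((signSum p.1 : ℝ) ^ 2 / (4 * h)) *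
      if signSum p.2 = -signSum p.1 then 1 else 0).trans_le ?_
  rw [Fintype.sum_prod_type]
  have hinner : ∀ a : {t // x t = 1} → ℤˣ, ∑ b : {t // ¬ x t = 1} → ℤˣ,
      Real.exp ((signSum a : ℝ) ^ 2 / (4 * h)) * (if signSum b = -signSum a then 1 else 0)
      ≤ Real.exp ((signSum a : ℝ) ^ 2 / (4 * h)) * (2 ^ h / √(h + 1)) := by
    intro a
    rw [← Finset.mul_sum, Finset.sum_boole]
    have := card_signSum_eq_le {t // ¬ x t = 1} (-signSum a)
    rw [hc'] at this
    gcongr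
  refine (Finset.sum_le_sum fun a _ => hinner a).trans ?_
  rw [← Finset.sum_mul, sum_signSum_reindex (Fintype.equivFinOfCardEq hc)
    fun z => Real.exp ((z : ℝ) ^ 2 / (4 * h))]
  have hB : (2 : ℝ) ^ h * 2 ^ h ≤ 2 * √h * #(balanced (2 * h)) := by
    rw [card_balanced]
    refine le_of_sq_le_sq ?_ (by positivity)
    have h16 : (16 : ℝ) ^ h ≤ (h.centralBinom : ℝ) ^ 2 * (4 * h) := by
      exact_mod_cast le_centralBinom_sq_mul hh
    calc ((2 : ℝ) ^ h * 2 ^ h) ^ 2 = 16 ^ h := by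
          rw [← mul_pow, ← pow_mul, mul_comm h 2, pow_mul]; norm_num
      _ ≤ _ := h16
      _ = _ := by rw [mul_pow, mul_pow, Real.sq_sqrt hh'.le]; ring
  calc _ ≤ (2 ^ h * Real.exp (1 / 2)) * (2 ^ h / √(h + 1)) := by
        gcongr; exact sum_exp_sq_signSum_le h
    _ = Real.exp (1 / 2) * ((2 ^ h * 2 ^ h) / √(h + 1)) := by ring
    _ ≤ Real.exp (1 / 2) * ((2 * √h * #(balanced (2 * h))) / √h) := by
        gcongr; linarith
    _ = _ := by field_simp

lemma sum_exp_mul_inner_signs {n : ℕ} (x : Fin n → ℤˣ) (t : ℝ) :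
    ∑ s : Fin n → ℤˣ, Real.exp (t * ∑ j, ((x j : ℤ) : ℝ) * (s j : ℤ))
      = (Real.exp t + Real.exp (-t)) ^ n := by
  simp_rw [Finset.mul_sum, Real.exp_sum]
  rw [← Fintype.prod_sum fun j (a : ℤˣ) => Real.exp (t * (((x j : ℤ) : ℝ) * (a : ℤ)))]
  have : ∀ j, ∑ a : ℤˣ, Real.exp (t * (((x j : ℤ) : ℝ) * (a : ℤ))) = Real.exp t + Real.exp (-t) := by
    intro j
    rw [sum_units_int]
    rcases Int.units_eq_one_or (x j) with h | h <;> simp [h, add_comm]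
  rw [Finset.prod_congr rfl fun j _ => this j]
  simp

/-- Few balanced vectors are almost parallel to a given one. -/
lemma card_large_overlap_le {n : ℕ} (hn : 0 < n) {u : Fin n → ℤ} (hu : u ∈ balanced n)
    {t δ : ℝ} (ht : 0 ≤ t) :
    (#{v ∈ balanced n | 1 - 2 * δ < |overlap u v|} : ℝ)
      ≤ 2 * Real.exp (n * (2 * t * δ + Real.exp (-(2 * t)))) := by
  obtain ⟨x, -, rfl⟩ := mem_balanced_iff.1 hu
  have hn' : (0 : ℝ) < n := by positivity
  have hmain : (#{v ∈ balanced n | 1 - 2 * δ < |overlap (fun j => (x j : ℤ)) v|} : ℝ) *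
      Real.exp (t * (n * (1 - 2 * δ))) ≤ 2 * (Real.exp t + Real.exp (-t)) ^ n := by
    have hpt : ∀ v ∈ balanced n, (if 1 - 2 * δ < |overlap (fun j => (x j : ℤ)) v| then
        Real.exp (t * (n * (1 - 2 * δ))) else 0)
        ≤ Real.exp (t * ∑ j, ((x j : ℤ) : ℝ) * v j) + Real.exp (-t * ∑ j, ((x j : ℤ) : ℝ) * v j) := by
      intro v _
      split_ifs with h
      · have h1 : n * (1 - 2 * δ) ≤ |∑ j, ((x j : ℤ) : ℝ) * v j| := by
          rw [overlap, abs_div, Nat.abs_cast, lt_div_iff₀ hn'] at h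
          linarith
        have h2 : t * (n * (1 - 2 * δ)) ≤ t * |∑ j, ((x j : ℤ) : ℝ) * v j| := by gcongr
        rcases abs_cases (∑ j, ((x j : ℤ) : ℝ) * v j) with ⟨h3, -⟩ | ⟨h3, -⟩
        · rw [h3] at h2
          exact (Real.exp_le_exp.2 h2).trans (le_add_of_nonneg_right (Real.exp_pos _).le)
        · rw [h3] at h2
          refine (Real.exp_le_exp.2 (h2.trans (le_of_eq ?_))).trans
            (le_add_of_nonneg_left (Real.exp_pos _).le)
          ring
      · positivity
    rw [← nsmul_eq_mul, ← Finset.sum_const, Finset.sum_filter]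
    refine (Finset.sum_le_sum hpt).trans ?_
    rw [sum_balanced]
    -- Dropping the balance constraint on `v` makes the exponential sum factor over coordinates.
    refine (Finset.sum_le_sum_of_subset_of_nonneg (Finset.filter_subset _ _)
      fun s _ _ => by positivity).trans (le_of_eq ?_)
    rw [Finset.sum_add_distrib, sum_exp_mul_inner_signs, sum_exp_mul_inner_signs, neg_neg]
    ring
  rw [← le_div_iff₀ (by positivity)] at hmain
  refine hmain.trans ?_
  have e1 : Real.exp t + Real.exp (-t) = Real.exp t * (1 + Real.exp (-(2 * t))) := by
    rw [mul_add, ← Real.exp_add]; ring_nf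
  have e2 : 1 + Real.exp (-(2 * t)) ≤ Real.exp (Real.exp (-(2 * t))) := by
    have := Real.add_one_le_exp (Real.exp (-(2 * t)))
    linarith
  rw [div_le_iff₀ (by positivity), mul_assoc, ← Real.exp_add, e1]
  calc 2 * (Real.exp t * (1 + Real.exp (-(2 * t)))) ^ n
      ≤ 2 * (Real.exp t * Real.exp (Real.exp (-(2 * t)))) ^ n := by gcongr
    _ = _ := by rw [← Real.exp_add, ← Real.exp_nat_mul]; ring_nf

/-- A chord bound by convexity: it turns a bounded exponential moment into `1 + O(a)`. -/
lemma exp_mul_le_one_add {a x : ℝ} (ha : 0 ≤ a) (ha1 : a ≤ 1) :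
    Real.exp (a * x) ≤ 1 + a * Real.exp x := by
  have := convexOn_exp.2 (Set.mem_univ 0) (Set.mem_univ x) (sub_nonneg.2 ha1) ha (by ring)
  simp only [smul_eq_mul, mul_zero, zero_add, Real.exp_zero, mul_one] at this
  linarith

/-! ### Second moment comparison -/

/-- A non-asymptotic second moment bound. -/
lemma momentZ_two_le {m h : ℕ} {lam : ℝ≥0} {w r : Fin m → ℕ} (hh : 1 ≤ h) (hl : 0 < lam)
    {C δ t D : ℝ} (hC : 0 ≤ C) (h0 : 0 < δ) (h1 : δ < 1 / 2) (ht : 0 ≤ t)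
    (hD : D = weakConst C δ / (1 - 2 * δ) ^ 2)
    (hw : ∀ i, Even (w i)) (hr : ∀ i, (r i : ℝ) ≤ C * √(w i)) (hm : 4 * D * m / h ≤ 1) :
    momentZ (condPoissonEnsemble m (2 * h) lam w) (window r) 2
      ≤ (1 + 4 * D * m / h * (2 * Real.exp (1 / 2))) *
          momentZ (condPoissonEnsemble m (2 * h) lam w) (window r) 1 ^ 2
        + momentZ (condPoissonEnsemble m (2 * h) lam w) (window r) 1 *
          (2 * Real.exp ((2 * h : ℕ) * (2 * t * δ + Real.exp (-(2 * t))))) := by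
  have hn : 0 < 2 * h := by omega
  have hh' : (0 : ℝ) < h := by positivity
  have hDpos : 0 < D := by
    have := weakConst_pos hC h0 h1
    have : 0 < 1 - 2 * δ := by linarith
    rw [hD]; positivity
  rw [momentZ_one hn hl, momentZ_two hn hl]
  set Ψ := ∏ i, walkProb (w i) (r i) with hΨ
  set B := balanced (2 * h)
  have hΨ0 : 0 ≤ Ψ := Finset.prod_nonneg fun i _ => walkProb_nonneg _ _
  have hpair0 : ∀ i ρ, 0 ≤ pairProb (w i) (r i) ρ := fun i ρ =>
    (sq_nonneg _).trans (sq_walkProb_le_pairProb _ _ _)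
  -- Nearly parallel pairs get the trivial bound by the probability for `u` alone; the others get
  -- the quadratic bound in each row.
  have hpt : ∀ u ∈ B, ∀ v ∈ B, ∏ i, pairProb (w i) (r i) (overlap u v)
      ≤ (1 + 4 * D * m / h * Real.exp (h * overlap u v ^ 2 / 4)) * Ψ ^ 2
        + (if 1 - 2 * δ < |overlap u v| then 1 else 0) * Ψ := by
    intro u hu v hv
    split_ifs with hbig
    · rw [one_mul]
      refine le_trans ?_ (le_add_of_nonneg_left (by positivity))
      exact Finset.prod_le_prod (fun i _ => hpair0 i _)
        fun i _ => pairProb_overlap_le_walkProb hn hu hv _ _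
    · rw [zero_mul, add_zero]
      have hprod : ∏ i, pairProb (w i) (r i) (overlap u v)
          ≤ ∏ i : Fin m, (Real.exp (D * overlap u v ^ 2) * walkProb (w i) (r i) ^ 2) := by
        refine Finset.prod_le_prod (fun i _ => hpair0 i _) fun i _ => ?_
        refine (pairProb_le_quadratic hC h0 h1 (hw i) (hr i) (not_lt.1 hbig)).trans ?_
        rw [← hD]
        gcongr
        rw [add_comm]
        exact Real.add_one_le_exp _
      rw [Finset.prod_mul_distrib, Finset.prod_const, Finset.prod_pow, ← hΨ, Finset.card_univ,
        Fintype.card_fin, ← Real.exp_nat_mul] at hprod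
      refine hprod.trans ?_
      gcongr
      -- The exponent `D m ρ²` is `4 D m / h` times `h ρ² / 4`.
      refine le_trans (le_of_eq ?_) (exp_mul_le_one_add (by positivity) hm)
      congr 1
      field_simp
  refine (Finset.sum_le_sum fun u hu => Finset.sum_le_sum fun v hv => hpt u hu v hv).trans ?_
  have hrow : ∀ u ∈ B, ∑ v ∈ B, ((1 + 4 * D * m / h * Real.exp (h * overlap u v ^ 2 / 4)) * Ψ ^ 2
        + (if 1 - 2 * δ < |overlap u v| then 1 else 0) * Ψ)
      ≤ (#B + 4 * D * m / h * (2 * Real.exp (1 / 2) * #B)) * Ψ ^ 2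
        + (2 * Real.exp ((2 * h : ℕ) * (2 * t * δ + Real.exp (-(2 * t))))) * Ψ := by
    intro u hu
    rw [Finset.sum_add_distrib, ← Finset.sum_mul, ← Finset.sum_mul, Finset.sum_add_distrib,
      ← Finset.mul_sum, Finset.sum_boole]
    have e1 := sum_balanced_exp_overlap_sq_le hh hu
    have e2 := card_large_overlap_le (t := t) (δ := δ) hn hu ht
    simp only [Finset.sum_const, nsmul_eq_mul, mul_one]
    gcongr
  refine (Finset.sum_le_sum hrow).trans (le_of_eq ?_)
  rw [Finset.sum_const, nsmul_eq_mul]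
  ring

lemma momentZ_two_le_of_lt_log {m n : ℕ} {lam : ℝ≥0} {w r : Fin m → ℕ} (hn : 0 < n)
    (hne : Even n) (hl : 0 < lam) {C δ c D : ℝ} (hC : 0 ≤ C) (h0 : 0 < δ) (h1 : δ < 1 / 2)
    (hc : 0 < c) (hδ : δ ≤ c ^ 2 / 16) (hD : D = weakConst C δ / (1 - 2 * δ) ^ 2)
    (hw : ∀ i, Even (w i)) (hr : ∀ i, (r i : ℝ) ≤ C * √(w i)) (hm : 8 * D * (m / n) ≤ 1)
    (hlog : c * n < Real.log (momentZ (condPoissonEnsemble m n lam w) (window r) 1)) :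
    momentZ (condPoissonEnsemble m n lam w) (window r) 2
      - momentZ (condPoissonEnsemble m n lam w) (window r) 1 ^ 2
      ≤ (16 * Real.exp (1 / 2) * D * (m / n) + 2 * Real.exp (-(c / 2 * n))) *
          momentZ (condPoissonEnsemble m n lam w) (window r) 1 ^ 2 := by
  obtain ⟨h, rfl⟩ := even_iff_exists_two_mul.1 hne
  have hh : 1 ≤ h := by omega
  have hh' : (0 : ℝ) < h := by positivity
  have hmh : 4 * D * m / h = 8 * D * (m / (2 * h : ℕ)) := by push_cast; field_simp; ring
  -- With `t = 2 / c` and `δ ≤ c² / 16`, both `2tδ` and `exp (-2t)` are at most `c / 4`, so nearly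
  -- parallel vectors number at most `2 exp (cn/2)`, against a mean above `exp (cn)`.
  have hmain := momentZ_two_le (t := 2 / c) hh hl hC h0 h1 (by positivity) hD hw hr
    (by rw [hmh]; exact hm)
  set E := momentZ (condPoissonEnsemble m (2 * h) lam w) (window r) 1 with hE
  have hE0 : 0 ≤ E := by
    rw [hE, momentZ_one hn hl]
    exact mul_nonneg (by positivity) (Finset.prod_nonneg fun i _ => walkProb_nonneg _ _)
  have hEpos : 0 < E := by
    -- A zero mean is excluded because `Real.log 0 = 0` is not above `c * n`.
    refine lt_of_le_of_ne hE0 fun hz => ?_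
    rw [← hz, Real.log_zero] at hlog
    have : 0 ≤ c * ((2 * h : ℕ) : ℝ) := by positivity
    linarith
  have hEexp : Real.exp (c * (2 * h : ℕ)) ≤ E := ((Real.lt_log_iff_exp_lt hEpos).1 hlog).le
  have hexpo : 2 * (2 / c) * δ + Real.exp (-(2 * (2 / c))) ≤ c / 2 := by
    have e1 : 2 * (2 / c) * δ ≤ c / 4 := by
      calc 2 * (2 / c) * δ ≤ 2 * (2 / c) * (c ^ 2 / 16) := by gcongr
        _ = c / 4 := by field_simp; ring
    have e2 : Real.exp (-(2 * (2 / c))) ≤ c / 4 := by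
      rw [Real.exp_neg, inv_le_comm₀ (by positivity) (by positivity)]
      have h3 := Real.add_one_le_exp (2 * (2 / c))
      refine le_trans (le_of_eq ?_) ((le_add_of_nonneg_right zero_le_one).trans h3)
      field_simp
      ring
    linarith
  have hX : 2 * Real.exp ((2 * h : ℕ) * (2 * (2 / c) * δ + Real.exp (-(2 * (2 / c)))))
      ≤ 2 * Real.exp (-(c / 2 * (2 * h : ℕ))) * E := by
    calc _ ≤ 2 * Real.exp ((2 * h : ℕ) * (c / 2)) := by gcongr
      _ = 2 * Real.exp (-(c / 2 * (2 * h : ℕ))) * Real.exp (c * (2 * h : ℕ)) := by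
          rw [mul_assoc, ← Real.exp_add]; congr 2; ring
      _ ≤ _ := by gcongr
  have := mul_le_mul_of_nonneg_left hX hE0
  rw [hmh] at hmain
  linarith

/-! ### The asymptotic statements -/

theorem mainTheorem5 (C₀ : ℝ) :
    ∃ (Cw : ℝ → ℝ) (C ε : ℝ),
      (∀ δ ∈ Set.Ioo (0 : ℝ) (1 / 2), 0 < Cw δ) ∧ 0 < C ∧ 0 < ε ∧
      ∀ (m n : ℕ → ℕ) (lam : ℕ → ℝ≥0) (w r : ∀ k, Fin (m k) → ℕ),
        Tendsto m atTop atTop →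
        ((fun k => (m k : ℝ)) =o[atTop] fun k => (n k : ℝ)) →
        (∀ k, Even (n k)) →
        (∀ k, 0 < lam k) →
        (∀ k i, Even (w k i)) →
        (∀ᶠ k in atTop, ∀ i, (r k i : ℝ) ≤ C₀ * Real.sqrt (w k i)) →
        WeakBound m n (fun k => condPoissonEnsemble (m k) (n k) (lam k) (w k))
            (fun k => window (r k)) Cw ∧
        StrongBound m n (fun k => condPoissonEnsemble (m k) (n k) (lam k) (w k))
            (fun k => window (r k)) C ε ∧
        ∀ c : ℝ, 0 < c →
          (∀ᶠ k in atTop, c * n k <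
            Real.log (momentZ (condPoissonEnsemble (m k) (n k) (lam k) (w k))
              (window (r k)) 1)) →
          (fun k => momentZ (condPoissonEnsemble (m k) (n k) (lam k) (w k)) (window (r k)) 2)
            ~[atTop] fun k =>
              momentZ (condPoissonEnsemble (m k) (n k) (lam k) (w k)) (window (r k)) 1 ^ 2 := by
  set C := max C₀ 0 with hCdef
  have hC : 0 ≤ C := le_max_right _ _
  -- The strong bound takes `δ = 1/4`, so `|ρ| ≤ 1/2` with `ρ = 2x`; the 16 is `4 / (1 - 2δ)²`.
  refine ⟨weakConst C, 16 * weakConst C (1 / 4), 1 / 4, fun δ hδ => weakConst_pos hC hδ.1 hδ.2,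
    mul_pos (by norm_num) (weakConst_pos hC (by norm_num) (by norm_num)), by norm_num, ?_⟩
  intro m n lam w r hm hmn hne hl hw hr
  have hr' : ∀ᶠ k in atTop, ∀ i, (r k i : ℝ) ≤ C * √(w k i) := by
    filter_upwards [hr] with k hk i
    exact (hk i).trans (mul_le_mul_of_nonneg_right (le_max_left _ _) (Real.sqrt_nonneg _))
  have hle : ∀ᶠ k in atTop, m k ≤ n k := by
    filter_upwards [isLittleO_iff.1 hmn one_pos] with k hk
    rw [Real.norm_natCast, Real.norm_natCast, one_mul] at hk
    exact_mod_cast hk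
  have hn : Tendsto n atTop atTop := tendsto_atTop_mono' _ hle hm
  have hnpos : ∀ᶠ k in atTop, 0 < n k := hn.eventually_gt_atTop 0
  -- The quadratic bound is exact, so `η = 0` suffices.
  refine ⟨?_, ⟨fun _ => 0, isLittleO_zero _ _, ?_⟩, ?_⟩
  · filter_upwards [hr', hnpos] with k hk hnk δ hδ i u hu v hv hag
    rw [phi_eq_pairProb hnk (hl k) hu hv, psi_eq_walkProb hnk (hl k) hu]
    rw [agreement_eq_overlap hnk hu hv] at hag
    exact pairProb_le_weakConst hC hδ.1 hδ.2 (hw k i) (hk i)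
      (abs_le.2 ⟨by linarith [hag.1], by linarith [hag.2]⟩)
  · filter_upwards [hr', hnpos] with k hk hnk i u hu v hv x hag hx
    rw [phi_eq_pairProb hnk (hl k) hu hv, psi_eq_walkProb hnk (hl k) hu]
    rw [agreement_eq_overlap hnk hu hv] at hag
    have hov : overlap u v = 2 * x := by linarith
    rw [hov]
    refine (pairProb_le_quadratic hC (δ := 1 / 4) (by norm_num) (by norm_num) (hw k i) (hk i)
      (by rw [abs_mul, abs_two]; linarith)).trans (le_of_eq ?_)
    ring
  · intro c hc hlog
    set δ := min (1 / 4) (c ^ 2 / 16) with hδdef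
    have h0 : 0 < δ := by positivity
    have h1 : δ < 1 / 2 := (min_le_left _ _).trans_lt (by norm_num)
    obtain ⟨D, hD⟩ : ∃ D, D = weakConst C δ / (1 - 2 * δ) ^ 2 := ⟨_, rfl⟩
    have hratio : Tendsto (fun k => (m k : ℝ) / n k) atTop (𝓝 0) := hmn.tendsto_div_nhds_zero
    have hsmall : ∀ᶠ k in atTop, 8 * D * ((m k : ℝ) / n k) ≤ 1 := by
      have := hratio.const_mul (8 * D)
      rw [mul_zero] at this
      exact this.eventually_le_const one_pos
    have hθ : Tendsto (fun k => 16 * Real.exp (1 / 2) * D * ((m k : ℝ) / n k)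
        + 2 * Real.exp (-(c / 2 * n k))) atTop (𝓝 0) := by
      have e1 := hratio.const_mul (16 * Real.exp (1 / 2) * D)
      have e2 : Tendsto (fun k => Real.exp (-(c / 2 * n k))) atTop (𝓝 0) :=
        Real.tendsto_exp_neg_atTop_nhds_zero.comp
          ((tendsto_natCast_atTop_atTop.comp hn).const_mul_atTop (by positivity))
      simpa using e1.add (e2.const_mul 2)
    refine isLittleO_iff.2 fun κ hκ => ?_
    filter_upwards [hr', hnpos, hlog, hsmall, hθ.eventually_le_const hκ] with k hk hnk hlk hsk hθk
    have hlow := sq_momentZ_one_le_momentZ_two (w := w k) (r := r k) hnk (hl k)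
    have hup := momentZ_two_le_of_lt_log hnk (hne k) (hl k) hC h0 h1 hc (min_le_right _ _) hD
      (hw k) hk hsk hlk
    rw [Pi.sub_apply, Real.norm_of_nonneg (sub_nonneg.2 hlow), Real.norm_of_nonneg (sq_nonneg _)]
    exact hup.trans (mul_le_mul_of_nonneg_right hθk (sq_nonneg _))
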